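/- Let $(M,\phi,\xi,\eta,g)$ be a $(2n+1)$-dimensional Kenmotsu manifold, i.e. $(M,g)$ is a smooth Riemannian manifold with a smooth $(1,1)$-tensor field $\phi$, a smooth vector field $\xi$ and a smooth $1$-form $\eta$ such that $$\phi^2=-I+\eta\otimes\xi,\quad \eta(\xi)=1,\quad \eta=g(\xi,\cdot),\quad g(\phi\cdot,\phi\cdot)=g-\eta\otimes\eta,$$ and such that the Levi-Civita connection $\nabla$ of $g$ satisfies $(\nabla_X\phi)Y=g(\phi X,Y)\xi-\eta(Y)\phi X$ for all vector fields $X,Y$. Let $a>0$ be a constant and let $$\overline g=a\,g+a(a-1)\,\eta\otimes\eta$$ be the metric of the $D$-homothetically deformed structure $(\overline\phi,\overline\xi,\overline\eta,\overline g)=(\phi,\tfrac1a\xi,a\eta,\overline g)$. Let $f,\overline\lambda\in C^\infty(M)$ and suppose that $V=\overline{\mathrm{grad}}(f)$, the gradient of $f$ with respect to $\overline g$, defines together with $\overline\lambda$ a gradient almost Riemann soliton on $(M,\overline g)$: $$\tfrac12\,(\mathcal L_V\overline g)\odot\overline g+\overline R=\overline\lambda\cdot\tfrac12\,\overline g\odot\overline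 g .$$ Here $\overline R(X,Y,Z,W)=\overline g(\overline R(X,Y)Z,W)$ with $\overline R(X,Y)=[\overline\nabla_X,\overline\nabla_Y]-\overline\nabla_{[X,Y]}$ is the Riemann curvature tensor of $\overline g$, and $$(T_1\odot T_2)(X,Y,Z,W)=T_1(X,W)T_2(Y,Z)+T_1(Y,Z)T_2(X,W)-T_1(X,Z)T_2(Y,W)-T_1(Y,W)T_2(X,Z).$$ Then, at every point of $M$, $$ \begin{aligned} |\mathrm{Ric}|_g^2\ \ge\ & (2n-1)^2|\mathrm{Hess}(f)|_g^2-4n\,\frac{a-1}{a}\,\mathrm{scal}-4n^2(2n+1)\Big(\frac{a-1}{a}\Big)^2\\ &-\frac{(2n-1)^2}{2n+1}(\Delta f)^2-\frac{2(2n-1)^2}{2n+1}\,\frac{a-1}{a}\,\big[\xi(f)-\xi(\xi(f))\big]\,\Delta f\\ &+\frac{2n(2n-1)^2}{2n+1}\Big(\frac{a-1}{a}\Big)^2(\xi(f))^2-\frac{2(2n-1)^2(n+na+a)(a-1)}{(2n+1)a^2}\,(\xi(\xi(f)))^2\\ &+\frac{2(2n-1)^2(2n+a)(a-1)}{(2n+1)a^2}\,\xi(f)\,\xi(\xi(f)),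 \end{aligned} $$ where $\mathrm{Ric}$, $\mathrm{scal}$, $\mathrm{Hess}(f)$ and $\Delta f=\mathrm{tr}_g\mathrm{Hess}(f)$ are the Ricci tensor, the scalar curvature, the Hessian and the Laplacian with respect to the original metric $g$, and $|T|_g^2=\sum_{i,j}T(E_i,E_j)^2$ (for any $g$-orthonormal frame $E_i$) is the squared Hilbert-Schmidt norm. -/

import Mathlib

open scoped Manifold ContDiff

noncomputable section

/-! ### Multilinear algebra of a metric `b` on a real vector space -/

section Algebra

variable {T : Type*} [AddCommGroup T] [Module ℝ T] [TopologicalSpace T]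
  [IsTopologicalAddGroup T] [ContinuousSMul ℝ T]
  {E : Type*} [NormedAddCommGroup E] [NormedSpace ℝ E]

/-- The musical isomorphism `T* → T` of a nondegenerate bilinear form `b`, i.e. the inverse of
`v ↦ b(v, ·)`. -/
def sharp (b : T →L[ℝ] T →L[ℝ] ℝ) : (T →L[ℝ] ℝ) →L[ℝ] T := b.inverse

/-- The trace of a `(0,2)`-tensor with respect to `b`; this is `∑ i, A(e_i, e_i)` for every
`b`-orthonormal basis `e`. -/
def metricTrace (b A : E →L[ℝ] E →L[ℝ] ℝ) : ℝ :=
  LinearMap.trace ℝ E (sharp b ∘L A).toLinearMap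

/-- The squared Hilbert-Schmidt norm of a `(0,2)`-tensor with respect to `b`, as the full
contraction `b^{ik} b^{jl} A_{ij} A_{kl}`; this is `∑ i j, A(e_i, e_j) ^ 2` for every
`b`-orthonormal basis `e`. -/
def hilbertSchmidtSq (b A : E →L[ℝ] E →L[ℝ] ℝ) : ℝ :=
  LinearMap.trace ℝ E (sharp b ∘L A ∘L sharp b ∘L A.flip).toLinearMap

/-- The Kulkarni-Nomizu product of two `(0,2)`-tensors. -/
def kulkarniNomizu (A B : E →L[ℝ] E →L[ℝ] ℝ) (X Y Z W : E) : ℝ :=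
  A X W * B Y Z + A Y Z * B X W - A X Z * B Y W - A Y W * B X Z

end Algebra

/-! ### Riemannian geometry in a coordinate domain

`G y` is the matrix of the metric at the point `y` of the vector space `E` of coordinates. -/

namespace Coord

variable {E : Type*} [NormedAddCommGroup E] [NormedSpace ℝ E]

/-- Christoffel symbols `Γ(u, v) = Γ^k_{ij} u^i v^j ∂_k` of the Levi-Civita connection of `G`:
`G(Γ(u, v), w) = (1/2) (∂_u G(v, w) + ∂_v G(u, w) - ∂_w G(u, v))`. -/
def christoffel (G : E → E →L[ℝ] E →L[ℝ] ℝ) (y : E) : E →L[ℝ] E →L[ℝ] E :=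
  let S := ContinuousLinearMap.compL ℝ E (E →L[ℝ] ℝ) E (sharp (G y))
  let D := fderiv ℝ G y
  let D' := (ContinuousLinearMap.flipₗᵢ ℝ E E ℝ).toContinuousLinearEquiv.toContinuousLinearMap ∘L
    D.flip
  (1 / 2 : ℝ) • (S ∘L D + S ∘L D.flip - S ∘L D')

/-- `(∇_u Φ) v` for the Levi-Civita connection of `G` and a `(1,1)`-tensor field `Φ`. -/
def covDerivEndo (G : E → E →L[ℝ] E →L[ℝ] ℝ) (Φ : E → E →L[ℝ] E) (y u v : E) : E :=
  fderiv ℝ Φ y u v + christoffel G y u (Φ y v) - Φ y (christoffel G y u v)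

/-- The Riemann curvature `u ↦ R(u, v) w`, where
`R(U, V) W = ∇_U ∇_V W - ∇_V ∇_U W - ∇_{[U, V]} W`. -/
def curvature (G : E → E →L[ℝ] E →L[ℝ] ℝ) (y v w : E) : E →ₗ[ℝ] E where
  toFun u := fderiv ℝ (christoffel G) y u v w - fderiv ℝ (christoffel G) y v u w
    + christoffel G y u (christoffel G y v w) - christoffel G y v (christoffel G y u w)
  map_add' u u' := by simp; abel
  map_smul' r u := by simp [smul_sub, smul_add]

/-- The Riemann curvature tensor of type `(0,4)`, `R(X, Y, Z, W) = G(R(X, Y) Z, W)`. -/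
def riemann (G : E → E →L[ℝ] E →L[ℝ] ℝ) (y X Y Z W : E) : ℝ :=
  G y (curvature G y Y Z X) W

/-- The Ricci tensor `Ric(v, w) = trace (u ↦ R(u, v) w)`. -/
def ricci [FiniteDimensional ℝ E] (G : E → E →L[ℝ] E →L[ℝ] ℝ) (y : E) : E →L[ℝ] E →L[ℝ] ℝ :=
  LinearMap.toContinuousBilinearMap <| LinearMap.mk₂ ℝ
    (fun v w ↦ LinearMap.trace ℝ E (curvature G y v w))
    (fun v v' w ↦ by
      rw [← map_add]; congr 1; ext u; simp [curvature]; abel)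
    (fun r v w ↦ by
      rw [← map_smul]; congr 1; ext u; simp [curvature, smul_sub, smul_add])
    (fun v w w' ↦ by
      rw [← map_add]; congr 1; ext u; simp [curvature]; abel)
    (fun r v w ↦ by
      rw [← map_smul]; congr 1; ext u; simp [curvature, smul_sub, smul_add])

/-- The Hessian `∂_u ∂_v F - dF(Γ(u, v))` of a function `F`. -/
def hessian (G : E → E →L[ℝ] E →L[ℝ] ℝ) (F : E → ℝ) (y : E) : E →L[ℝ] E →L[ℝ] ℝ :=
  fderiv ℝ (fderiv ℝ F) y -
    ContinuousLinearMap.compL ℝ E E ℝ (fderiv ℝ F y) ∘L christoffel G y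

/-- The Lie derivative `L_V G = V^k ∂_k G_{ij} + G_{kj} ∂_i V^k + G_{ik} ∂_j V^k`. -/
def lieDerivMetric (G : E → E →L[ℝ] E →L[ℝ] ℝ) (V : E → E) (y : E) : E →L[ℝ] E →L[ℝ] ℝ :=
  fderiv ℝ G y (V y) + G y ∘L fderiv ℝ V y + ((G y).flip ∘L fderiv ℝ V y).flip

end Coord

/-! ### Tensor fields on a manifold, read in a chart -/

section Manifold

variable {E : Type*} [NormedAddCommGroup E] [NormedSpace ℝ E]
  {M : Type*} [TopologicalSpace M] [ChartedSpace E M]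

/-- The differential `T_x M → E` of a chart. -/
def chartDeriv (c : OpenPartialHomeomorph M E) (x : M) : TangentSpace 𝓘(ℝ, E) x →L[ℝ] E :=
  mfderiv 𝓘(ℝ, E) 𝓘(ℝ, E) c x

/-- The differential `E → T_x M` of the inverse of a chart, where `x = c⁻¹(y)`. -/
def chartSymmDeriv (c : OpenPartialHomeomorph M E) (y : E) :
    E →L[ℝ] TangentSpace 𝓘(ℝ, E) (c.symm y) :=
  mfderiv 𝓘(ℝ, E) 𝓘(ℝ, E) c.symm y

/-- A vector field in the chart `c`. -/
def fieldIn (c : OpenPartialHomeomorph M E) (X : Π x : M, TangentSpace 𝓘(ℝ, E) x) (y : E) : E :=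
  chartDeriv c (c.symm y) (X (c.symm y))

/-- A `1`-form in the chart `c`. -/
def formIn (c : OpenPartialHomeomorph M E) (α : Π x : M, TangentSpace 𝓘(ℝ, E) x →L[ℝ] ℝ) (y : E) :
    E →L[ℝ] ℝ :=
  α (c.symm y) ∘L chartSymmDeriv c y

/-- A `(1,1)`-tensor field in the chart `c`. -/
def endoIn (c : OpenPartialHomeomorph M E)
    (Φ : Π x : M, TangentSpace 𝓘(ℝ, E) x →L[ℝ] TangentSpace 𝓘(ℝ, E) x) (y : E) : E →L[ℝ] E :=
  chartDeriv c (c.symm y) ∘L Φ (c.symm y) ∘L chartSymmDeriv c y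

/-- A `(0,2)`-tensor field in the chart `c`. -/
def bilinIn (c : OpenPartialHomeomorph M E)
    (A : Π x : M, TangentSpace 𝓘(ℝ, E) x →L[ℝ] TangentSpace 𝓘(ℝ, E) x →L[ℝ] ℝ) (y : E) :
    E →L[ℝ] E →L[ℝ] ℝ :=
  (chartSymmDeriv c y).precomp ℝ ∘L A (c.symm y) ∘L chartSymmDeriv c y

/-! ### Riemannian geometry on a manifold

Identities between tensors are read in all charts. The scalars below are computed in the preferred
chart at each point; being full contractions of tensors, they do not depend on the chart. -/

/-- The directional derivative `X(f)`. -/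
def dirDeriv (X : Π x : M, TangentSpace 𝓘(ℝ, E) x) (f : M → ℝ) (p : M) : ℝ :=
  mfderiv 𝓘(ℝ, E) 𝓘(ℝ, ℝ) f p (X p)

/-- The gradient of `f` with respect to `g`. -/
def grad (g : Π x : M, TangentSpace 𝓘(ℝ, E) x →L[ℝ] TangentSpace 𝓘(ℝ, E) x →L[ℝ] ℝ)
    (f : M → ℝ) (p : M) : TangentSpace 𝓘(ℝ, E) p :=
  sharp (g p) (mfderiv 𝓘(ℝ, E) 𝓘(ℝ, ℝ) f p)

/-- The scalar curvature of `g`, the trace of the Ricci tensor. -/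
def scal [FiniteDimensional ℝ E]
    (g : Π x : M, TangentSpace 𝓘(ℝ, E) x →L[ℝ] TangentSpace 𝓘(ℝ, E) x →L[ℝ] ℝ) (p : M) : ℝ :=
  let c := chartAt E p
  metricTrace (bilinIn c g (c p)) (Coord.ricci (bilinIn c g) (c p))

/-- The squared norm `|Ric|²` of the Ricci tensor of `g` with respect to `g`. -/
def ricciNormSq [FiniteDimensional ℝ E]
    (g : Π x : M, TangentSpace 𝓘(ℝ, E) x →L[ℝ] TangentSpace 𝓘(ℝ, E) x →L[ℝ] ℝ) (p : M) : ℝ :=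
  let c := chartAt E p
  hilbertSchmidtSq (bilinIn c g (c p)) (Coord.ricci (bilinIn c g) (c p))

/-- The Laplacian of `f` with respect to `g`, the trace of the Hessian. -/
def laplacian (g : Π x : M, TangentSpace 𝓘(ℝ, E) x →L[ℝ] TangentSpace 𝓘(ℝ, E) x →L[ℝ] ℝ)
    (f : M → ℝ) (p : M) : ℝ :=
  let c := chartAt E p
  metricTrace (bilinIn c g (c p)) (Coord.hessian (bilinIn c g) (f ∘ c.symm) (c p))

/-- The squared norm `|Hess f|²` of the Hessian of `f` with respect to `g`. -/
def hessNormSq (g : Π x : M, TangentSpace 𝓘(ℝ, E) x →L[ℝ] TangentSpace 𝓘(ℝ, E) x →L[ℝ] ℝ)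
    (f : M → ℝ) (p : M) : ℝ :=
  let c := chartAt E p
  hilbertSchmidtSq (bilinIn c g (c p)) (Coord.hessian (bilinIn c g) (f ∘ c.symm) (c p))

/-- `(V, lam)` defines an almost Riemann soliton for the metric `g`: `lam` is a smooth function and
`(1/2) L_V g ⊙ g + R = lam G` with `G = (1/2) g ⊙ g`. Zeros of `V` are allowed. -/
structure IsAlmostRiemannSoliton [IsManifold 𝓘(ℝ, E) ∞ M]
    (g : Π x : M, TangentSpace 𝓘(ℝ, E) x →L[ℝ] TangentSpace 𝓘(ℝ, E) x →L[ℝ] ℝ)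
    (V : Π x : M, TangentSpace 𝓘(ℝ, E) x) (lam : M → ℝ) : Prop where
  smooth_field : ContMDiff 𝓘(ℝ, E) (𝓘(ℝ, E).prod 𝓘(ℝ, E)) ∞
    (fun x ↦ Bundle.TotalSpace.mk' E (E := fun x : M ↦ TangentSpace 𝓘(ℝ, E) x) x (V x))
  smooth_lam : ContMDiff 𝓘(ℝ, E) 𝓘(ℝ, ℝ) ∞ lam
  equation : ∀ c ∈ atlas E M, ∀ y ∈ c.target, ∀ X Y Z W : E,
    (1 / 2) * kulkarniNomizu (Coord.lieDerivMetric (bilinIn c g) (fieldIn c V) y)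
        (bilinIn c g y) X Y Z W
      + Coord.riemann (bilinIn c g) y X Y Z W =
    lam (c.symm y) * ((1 / 2) * kulkarniNomizu (bilinIn c g y) (bilinIn c g y) X Y Z W)

/-! ### Almost contact metric structures -/

variable (E M) in
/-- A (smooth) almost contact metric structure `(φ, ξ, η, g)` on the manifold `M`. -/
structure AlmostContactMetricStructure [IsManifold 𝓘(ℝ, E) ∞ M] where
  /-- the Riemannian metric -/
  metric : Bundle.ContMDiffRiemannianMetric 𝓘(ℝ, E) ∞ E
    (fun x : M ↦ TangentSpace 𝓘(ℝ, E) x)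
  /-- the `(1,1)`-tensor field -/
  φ : Π x : M, TangentSpace 𝓘(ℝ, E) x →L[ℝ] TangentSpace 𝓘(ℝ, E) x
  /-- the Reeb vector field -/
  ξ : Π x : M, TangentSpace 𝓘(ℝ, E) x
  /-- the `1`-form -/
  η : Π x : M, TangentSpace 𝓘(ℝ, E) x →L[ℝ] ℝ
  contMDiff_φ : ContMDiff 𝓘(ℝ, E) (𝓘(ℝ, E).prod 𝓘(ℝ, E →L[ℝ] E)) ∞
    (fun x ↦ Bundle.TotalSpace.mk' (E →L[ℝ] E)
      (E := fun x : M ↦ TangentSpace 𝓘(ℝ, E) x →L[ℝ] TangentSpace 𝓘(ℝ, E) x) x (φ x))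
  contMDiff_ξ : ContMDiff 𝓘(ℝ, E) (𝓘(ℝ, E).prod 𝓘(ℝ, E)) ∞
    (fun x ↦ Bundle.TotalSpace.mk' E (E := fun x : M ↦ TangentSpace 𝓘(ℝ, E) x) x (ξ x))
  contMDiff_η : ContMDiff 𝓘(ℝ, E) (𝓘(ℝ, E).prod 𝓘(ℝ, E →L[ℝ] ℝ)) ∞
    (fun x ↦ Bundle.TotalSpace.mk' (E →L[ℝ] ℝ)
      (E := fun x : M ↦ TangentSpace 𝓘(ℝ, E) x →L[ℝ] Bundle.Trivial M ℝ x) x (η x))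
  φ_φ : ∀ x v, φ x (φ x v) = -v + η x v • ξ x
  η_ξ : ∀ x, η x (ξ x) = 1
  η_eq : ∀ x v, η x v = metric.inner x (ξ x) v
  metric_φ_φ : ∀ x v w, metric.inner x (φ x v) (φ x w) = metric.inner x v w - η x v * η x w

namespace AlmostContactMetricStructure

variable [IsManifold 𝓘(ℝ, E) ∞ M] (S : AlmostContactMetricStructure E M)

/-- The metric `g`, as a `(0,2)`-tensor field. -/
def g (x : M) : TangentSpace 𝓘(ℝ, E) x →L[ℝ] TangentSpace 𝓘(ℝ, E) x →L[ℝ] ℝ := S.metric.inner x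

/-- The Kenmotsu condition `(∇_X φ) Y = g(φ X, Y) ξ - η(Y) φ X`, read in every chart. -/
def IsKenmotsu : Prop :=
  ∀ c ∈ atlas E M, ∀ y ∈ c.target, ∀ u v : E,
    Coord.covDerivEndo (bilinIn c S.g) (endoIn c S.φ) y u v =
      bilinIn c S.g y (endoIn c S.φ y u) v • fieldIn c S.ξ y -
        formIn c S.η y v • endoIn c S.φ y u

/-- The metric `a g + a (a - 1) η ⊗ η` of the `D`-homothetic deformation with constant `a`. -/
def deformedMetric (a : ℝ) (x : M) :
    TangentSpace 𝓘(ℝ, E) x →L[ℝ] TangentSpace 𝓘(ℝ, E) x →L[ℝ] ℝ :=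
  a • S.g x + (a * (a - 1)) • (S.η x).smulRight (S.η x)

end AlmostContactMetricStructure

end Manifold

end

/-!
Write `N` for the dimension of `M` and `k = (a - 1) / a`. Differentiating `φ ξ = 0` on a Kenmotsu
manifold gives `∇ξ = I - η ⊗ ξ`. Therefore the deformation changes the connection only by the
tensor `k (g - η ⊗ η) ⊗ ξ`, and the Ricci tensor and the Hessian only by multiples of `g - η ⊗ η`.
Contracting the soliton equation expresses the deformed Ricci tensor through the deformed Hessian
and metric; the unknown factor of the metric is found by evaluating at `(ξ, ξ)`, where
`Ric(ξ, ξ) = 1 - N`. Rewritten in terms of `g`, the result is that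
`Ric + (N - 2) (Hess f + k (ξ(f) - ξ(ξ(f))) η ⊗ η)` is a multiple of `g`.
Hence the trace-free parts of `Ric` and of `-(N - 2) (Hess f + k (ξ(f) - ξ(ξ(f))) η ⊗ η)` agree, and
the inequality says that the norm of `Ric + (N - 1) k g` is at least that of its trace-free part.
-/

section MetricInverse

variable {T : Type*} [AddCommGroup T] [Module ℝ T] [TopologicalSpace T]
  {b : T →L[ℝ] T →L[ℝ] ℝ}

theorem sharp_apply_self (hb : b.IsInvertible) (u : T) : sharp b (b u) = u :=
  hb.inverse_apply_self u

theorem apply_sharp (hb : b.IsInvertible) (α : T →L[ℝ] ℝ) : b (sharp b α) = α :=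
  hb.self_apply_inverse α

theorem eq_of_forall_apply_eq (hb : b.IsInvertible) {u v : T} (h : ∀ w, b u w = b v w) : u = v :=
  hb.injective (ContinuousLinearMap.ext h)

theorem isInvertible_smul_add_smulRight [IsTopologicalAddGroup T] [ContinuousSMul ℝ T]
    (hb : b.IsInvertible) {ξ : T} (hξ : ∀ u, b u ξ = b ξ u) {r s : ℝ} (hr : r ≠ 0)
    (hrs : r + s * b ξ ξ ≠ 0) : (r • b + s • (b ξ).smulRight (b ξ)).IsInvertible := by
  -- The Sherman-Morrison formula for the inverse of a rank one perturbation.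
  refine .of_inverse (g := r⁻¹ • (sharp b -
    (s / (r + s * b ξ ξ)) • ((b ξ) ∘L sharp b).smulRight ξ)) ?_ ?_
  · ext α v
    simp only [ContinuousLinearMap.comp_apply, smul_apply, sub_apply, add_apply, map_smul, map_sub,
      ContinuousLinearMap.smulRight_apply, ContinuousLinearMap.id_apply, apply_sharp hb,
      smul_eq_mul]
    field_simp
    ring
  · refine ContinuousLinearMap.ext fun u ↦ ?_
    simp only [ContinuousLinearMap.comp_apply, smul_apply, sub_apply, add_apply,
      ContinuousLinearMap.smulRight_apply, ContinuousLinearMap.id_apply, map_add, map_smul,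
      sharp_apply_self hb, hξ]
    match_scalars <;> field_simp
    ring

end MetricInverse

theorem isInvertible_of_forall_apply_self_pos {E : Type*} [NormedAddCommGroup E] [NormedSpace ℝ E]
    [FiniteDimensional ℝ E] {b : E →L[ℝ] E →L[ℝ] ℝ} (hb : ∀ u, u ≠ 0 → 0 < b u u) :
    b.IsInvertible := by
  have hinj : Function.Injective b.toLinearMap := by
    refine (injective_iff_map_eq_zero _).2 fun u hu ↦ ?_
    by_contra h
    exact (hb u h).ne' (DFunLike.congr_fun hu u)
  have hdim : Module.finrank ℝ E = Module.finrank ℝ (E →L[ℝ] ℝ) := by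
    rw [← (LinearMap.toContinuousLinearMap (𝕜 := ℝ) (E := E) (F' := ℝ)).finrank_eq]
    exact Subspace.dual_finrank_eq.symm
  exact ⟨(b.toLinearMap.linearEquivOfInjective hinj hdim).toContinuousLinearEquiv, rfl⟩

section MetricContraction

variable {E : Type*} [NormedAddCommGroup E] [NormedSpace ℝ E] {b : E →L[ℝ] E →L[ℝ] ℝ}

theorem metricTrace_add (b A B : E →L[ℝ] E →L[ℝ] ℝ) :
    metricTrace b (A + B) = metricTrace b A + metricTrace b B := by
  rw [metricTrace, ContinuousLinearMap.comp_add, ContinuousLinearMap.toLinearMap_add, map_add]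
  rfl

theorem metricTrace_smul (b A : E →L[ℝ] E →L[ℝ] ℝ) (r : ℝ) :
    metricTrace b (r • A) = r * metricTrace b A := by
  rw [metricTrace, ContinuousLinearMap.comp_smul, ContinuousLinearMap.toLinearMap_smul, map_smul]
  rfl

theorem hilbertSchmidtSq_smul (b A : E →L[ℝ] E →L[ℝ] ℝ) (r : ℝ) :
    hilbertSchmidtSq b (r • A) = r ^ 2 * hilbertSchmidtSq b A := by
  have h : (sharp b ∘L (r • A) ∘L sharp b ∘L (r • A).flip).toLinearMap =
      r ^ 2 • (sharp b ∘L A ∘L sharp b ∘L A.flip).toLinearMap := by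
    ext u
    simp [smul_smul, sq]
  rw [hilbertSchmidtSq, h, map_smul]
  rfl

theorem hilbertSchmidtSq_add {A B : E →L[ℝ] E →L[ℝ] ℝ} (hA : ∀ u v, A u v = A v u)
    (hB : ∀ u v, B u v = B v u) :
    hilbertSchmidtSq b (A + B) = hilbertSchmidtSq b A +
      2 * LinearMap.trace ℝ E ((sharp b ∘L A).toLinearMap * (sharp b ∘L B).toLinearMap) +
      hilbertSchmidtSq b B := by
  have eq_trace_sq : ∀ {C : E →L[ℝ] E →L[ℝ] ℝ}, (∀ u v, C u v = C v u) → hilbertSchmidtSq b C =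
      LinearMap.trace ℝ E ((sharp b ∘L C).toLinearMap * (sharp b ∘L C).toLinearMap) := by
    intro C hC
    have hflip : C.flip = C := by ext u v; exact hC v u
    rw [hilbertSchmidtSq, hflip]
    rfl
  rw [eq_trace_sq hA, eq_trace_sq hB, eq_trace_sq fun u v ↦ by simp [hA u v, hB u v],
    ContinuousLinearMap.comp_add, ContinuousLinearMap.toLinearMap_add]
  simp only [add_mul, mul_add, map_add,
    LinearMap.trace_mul_comm ℝ (sharp b ∘L B).toLinearMap (sharp b ∘L A).toLinearMap]
  ring

theorem metricTrace_self [FiniteDimensional ℝ E] (hb : b.IsInvertible) :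
    metricTrace b b = Module.finrank ℝ E := by
  rw [metricTrace, sharp, hb.inverse_comp_self]
  exact LinearMap.trace_id ℝ E

theorem metricTrace_smulRight_apply [FiniteDimensional ℝ E] (hb : b.IsInvertible)
    (α : E →L[ℝ] ℝ) (ξ : E) : metricTrace b (α.smulRight (b ξ)) = α ξ := by
  have h : (sharp b ∘L α.smulRight (b ξ)).toLinearMap = α.toLinearMap.smulRight ξ := by
    ext u
    simp [sharp_apply_self hb]
  rw [metricTrace, h, LinearMap.trace_smulRight]
  rfl

theorem hilbertSchmidtSq_add_smul_self [FiniteDimensional ℝ E] (hb : b.IsInvertible)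
    (hsymm : ∀ u v, b u v = b v u) {A : E →L[ℝ] E →L[ℝ] ℝ} (hA : ∀ u v, A u v = A v u) (r : ℝ) :
    hilbertSchmidtSq b (A + r • b) =
      hilbertSchmidtSq b A + 2 * r * metricTrace b A + r ^ 2 * Module.finrank ℝ E := by
  have sharp_self : (sharp b ∘L b).toLinearMap = 1 := by
    rw [sharp, hb.inverse_comp_self]
    rfl
  have norm_self : hilbertSchmidtSq b b = Module.finrank ℝ E := by
    have hflip : b.flip = b := by ext u v; exact hsymm v u
    rw [hilbertSchmidtSq, hflip, ← ContinuousLinearMap.comp_assoc, sharp, hb.inverse_comp_self]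
    exact LinearMap.trace_id ℝ E
  rw [hilbertSchmidtSq_add hA fun u v ↦ by simp [hsymm u v], hilbertSchmidtSq_smul, norm_self,
    ContinuousLinearMap.comp_smul, ContinuousLinearMap.toLinearMap_smul, sharp_self,
    mul_smul_comm, mul_one, map_smul, metricTrace, smul_eq_mul]
  ring

theorem hilbertSchmidtSq_add_smul_smulRight [FiniteDimensional ℝ E] (hb : b.IsInvertible)
    (hsymm : ∀ u v, b u v = b v u) {A : E →L[ℝ] E →L[ℝ] ℝ} (hA : ∀ u v, A u v = A v u) (ξ : E)
    (r : ℝ) : hilbertSchmidtSq b (A + r • (b ξ).smulRight (b ξ)) =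
      hilbertSchmidtSq b A + 2 * r * A ξ ξ + (r * b ξ ξ) ^ 2 := by
  set P : E →L[ℝ] E →L[ℝ] ℝ := (b ξ).smulRight (b ξ) with hP
  have hP_flip : P.flip = P := by ext u v; simp [hP, mul_comm]
  have trace_mul (C : E →L[ℝ] E →L[ℝ] ℝ) :
      LinearMap.trace ℝ E ((sharp b ∘L C).toLinearMap * (sharp b ∘L P).toLinearMap) = C ξ ξ := by
    have h : (sharp b ∘L C).toLinearMap * (sharp b ∘L P).toLinearMap =
        (b ξ).toLinearMap.smulRight (sharp b (C ξ)) := by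
      ext u
      simp [hP, sharp_apply_self hb]
    rw [h, LinearMap.trace_smulRight, ContinuousLinearMap.coe_coe, hsymm, apply_sharp hb]
  have norm_P : hilbertSchmidtSq b P = b ξ ξ ^ 2 := by
    have h := trace_mul P
    rw [hilbertSchmidtSq, hP_flip]
    refine h.trans ?_
    simp [hP, sq]
  rw [hilbertSchmidtSq_add hA fun u v ↦ by simp [hP, mul_comm], hilbertSchmidtSq_smul, norm_P,
    ContinuousLinearMap.comp_smul, ContinuousLinearMap.toLinearMap_smul, mul_smul_comm, map_smul,
    trace_mul, smul_eq_mul]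
  ring

/-- The squared Hilbert-Schmidt norm of the trace-free part `A - (tr A / dim E) b` of a
`(0,2)`-tensor `A` with respect to `b`, by which two tensors can be compared up to multiples
of `b`. -/
noncomputable def tracelessNormSq (b A : E →L[ℝ] E →L[ℝ] ℝ) : ℝ :=
  hilbertSchmidtSq b A - metricTrace b A ^ 2 / Module.finrank ℝ E

theorem tracelessNormSq_le_hilbertSchmidtSq (b A : E →L[ℝ] E →L[ℝ] ℝ) :
    tracelessNormSq b A ≤ hilbertSchmidtSq b A :=
  sub_le_self _ (by positivity)

theorem tracelessNormSq_smul (b A : E →L[ℝ] E →L[ℝ] ℝ) (r : ℝ) :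
    tracelessNormSq b (r • A) = r ^ 2 * tracelessNormSq b A := by
  rw [tracelessNormSq, tracelessNormSq, hilbertSchmidtSq_smul, metricTrace_smul]
  ring

theorem tracelessNormSq_add_smul_self [FiniteDimensional ℝ E] [Nontrivial E] (hb : b.IsInvertible)
    (hsymm : ∀ u v, b u v = b v u) {A : E →L[ℝ] E →L[ℝ] ℝ} (hA : ∀ u v, A u v = A v u) (r : ℝ) :
    tracelessNormSq b (A + r • b) = tracelessNormSq b A := by
  have hdim : (Module.finrank ℝ E : ℝ) ≠ 0 := by exact_mod_cast Module.finrank_pos.ne'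
  rw [tracelessNormSq, tracelessNormSq, hilbertSchmidtSq_add_smul_self hb hsymm hA,
    metricTrace_add, metricTrace_smul, metricTrace_self hb]
  field_simp
  ring

theorem sq_mul_tracelessNormSq_le_of_eq_smul_add_smul_self [FiniteDimensional ℝ E] [Nontrivial E]
    (hb : b.IsInvertible) (hsymm : ∀ u v, b u v = b v u) {A B : E →L[ℝ] E →L[ℝ] ℝ}
    (hB : ∀ u v, B u v = B v u) {m r : ℝ} (hAB : A = m • B + r • b) (s : ℝ) :
    m ^ 2 * tracelessNormSq b B ≤
      hilbertSchmidtSq b A + 2 * s * metricTrace b A + s ^ 2 * Module.finrank ℝ E := by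
  have hmB (u v : E) : (m • B) u v = (m • B) v u := by simp [hB u v]
  have hA (u v : E) : A u v = A v u := by simp [hAB, hB u v, hsymm u v]
  calc m ^ 2 * tracelessNormSq b B
      = tracelessNormSq b A := by
        rw [hAB, tracelessNormSq_add_smul_self hb hsymm hmB, tracelessNormSq_smul]
    _ = tracelessNormSq b (A + s • b) := (tracelessNormSq_add_smul_self hb hsymm hA s).symm
    _ ≤ hilbertSchmidtSq b (A + s • b) := tracelessNormSq_le_hilbertSchmidtSq _ _
    _ = _ := hilbertSchmidtSq_add_smul_self hb hsymm hA s

theorem tracelessNormSq_add_smul_smulRight [FiniteDimensional ℝ E] (hb : b.IsInvertible)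
    (hsymm : ∀ u v, b u v = b v u) {A : E →L[ℝ] E →L[ℝ] ℝ} (hA : ∀ u v, A u v = A v u) (ξ : E)
    (r : ℝ) : tracelessNormSq b (A + r • (b ξ).smulRight (b ξ)) =
      hilbertSchmidtSq b A + 2 * r * A ξ ξ + (r * b ξ ξ) ^ 2
        - (metricTrace b A + r * b ξ ξ) ^ 2 / Module.finrank ℝ E := by
  rw [tracelessNormSq, hilbertSchmidtSq_add_smul_smulRight hb hsymm hA, metricTrace_add,
    metricTrace_smul, metricTrace_smulRight_apply hb]

end MetricContraction

namespace Coord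

section Calculus

variable {E F : Type*} [NormedAddCommGroup E] [NormedSpace ℝ E] [NormedAddCommGroup F]
  [NormedSpace ℝ F] {y : E}

theorem fderiv_apply_eq {A : E → E →L[ℝ] F} {V : E → E} (hA : DifferentiableAt ℝ A y)
    (hV : DifferentiableAt ℝ V y) (u : E) :
    fderiv ℝ (fun z ↦ A z (V z)) y u = fderiv ℝ A y u (V y) + A y (fderiv ℝ V y u) := by
  rw [fderiv_clm_apply hA hV]
  simp [add_comm]

theorem fderiv_apply_const {A : E → E →L[ℝ] F} (hA : DifferentiableAt ℝ A y) (u v : E) :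
    fderiv ℝ (fun z ↦ A z v) y u = fderiv ℝ A y u v := by
  simp [fderiv_apply_eq hA (differentiableAt_const v)]

theorem fderiv_apply_apply_const {A : E → E →L[ℝ] E →L[ℝ] F} (hA : DifferentiableAt ℝ A y)
    (u v w : E) : fderiv ℝ (fun z ↦ A z v w) y u = fderiv ℝ A y u v w := by
  rw [fderiv_apply_const (A := fun z ↦ A z v) (by fun_prop), fderiv_apply_const hA]

end Calculus

variable {E : Type*} [NormedAddCommGroup E] [NormedSpace ℝ E] {U : Set E}
  {G : E → E →L[ℝ] E →L[ℝ] ℝ} {y : E}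

/-- The covariant derivative `u ↦ ∇_u X` of a vector field for the Levi-Civita connection
of `G`. -/
noncomputable def covDeriv (G : E → E →L[ℝ] E →L[ℝ] ℝ) (X : E → E) (y : E) : E →L[ℝ] E :=
  fderiv ℝ X y + (christoffel G y).flip (X y)

theorem covDeriv_apply (G : E → E →L[ℝ] E →L[ℝ] ℝ) (X : E → E) (y u : E) :
    covDeriv G X y u = fderiv ℝ X y u + christoffel G y u (X y) := rfl

theorem covDerivEndo_apply_field (G : E → E →L[ℝ] E →L[ℝ] ℝ) {Φ : E → E →L[ℝ] E} {X : E → E}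
    (hΦ : DifferentiableAt ℝ Φ y) (hX : DifferentiableAt ℝ X y) (u : E) :
    covDerivEndo G Φ y u (X y) = covDeriv G (fun z ↦ Φ z (X z)) y u - Φ y (covDeriv G X y u) := by
  rw [covDerivEndo, covDeriv_apply, covDeriv_apply, fderiv_apply_eq hΦ hX, map_add]
  abel

theorem curvature_apply (G : E → E →L[ℝ] E →L[ℝ] ℝ) (y u v w : E) :
    curvature G y v w u = fderiv ℝ (christoffel G) y u v w - fderiv ℝ (christoffel G) y v u w
      + christoffel G y u (christoffel G y v w) - christoffel G y v (christoffel G y u w) := rfl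

theorem curvature_apply_field (hΓ : DifferentiableAt ℝ (christoffel G) y) {X : E → E}
    (hX : ContDiffAt ℝ 2 X y) (u v : E) :
    curvature G y v (X y) u =
      covDeriv G (fun z ↦ covDeriv G X z v) y u - covDeriv G (fun z ↦ covDeriv G X z u) y v := by
  have hX₁ : DifferentiableAt ℝ X y := hX.differentiableAt (by simp)
  have hX₂ : DifferentiableAt ℝ (fderiv ℝ X) y :=
    (hX.fderiv_right (m := 1) le_rfl).differentiableAt (by simp)
  have hX_symm : IsSymmSndFDerivAt ℝ X y := hX.isSymmSndFDerivAt (by simp)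
  have second_covDeriv (u v : E) : covDeriv G (fun z ↦ covDeriv G X z v) y u =
      fderiv ℝ (fderiv ℝ X) y u v + fderiv ℝ (christoffel G) y u v (X y)
        + christoffel G y v (fderiv ℝ X y u) + christoffel G y u (covDeriv G X y v) := by
    simp only [covDeriv_apply G _ _ v]
    rw [covDeriv_apply, fderiv_fun_add (by fun_prop) (by fun_prop), add_apply,
      fderiv_apply_const hX₂, fderiv_apply_eq (A := fun z ↦ christoffel G z v) (by fun_prop) hX₁,
      fderiv_apply_const hΓ]
    abel
  rw [curvature_apply, second_covDeriv, second_covDeriv, hX_symm.eq u v]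
  simp only [covDeriv_apply, map_add]
  abel

theorem fderiv_fderiv_apply_field (G : E → E →L[ℝ] E →L[ℝ] ℝ) {F : E → ℝ}
    (hF : ContDiffAt ℝ 2 F y) {X : E → E} (hX : DifferentiableAt ℝ X y) (u : E) :
    fderiv ℝ (fun z ↦ fderiv ℝ F z (X z)) y u =
      hessian G F y u (X y) + fderiv ℝ F y (covDeriv G X y u) := by
  have hF' : DifferentiableAt ℝ (fderiv ℝ F) y :=
    (hF.fderiv_right (m := 1) le_rfl).differentiableAt (by simp)
  rw [fderiv_apply_eq hF' hX]
  simp [hessian, covDeriv_apply]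

theorem ricci_apply [FiniteDimensional ℝ E] (G : E → E →L[ℝ] E →L[ℝ] ℝ) (y v w : E) :
    ricci G y v w = LinearMap.trace ℝ E (curvature G y v w) := rfl

theorem ricci_eq_of_kulkarniNomizu [FiniteDimensional ℝ E] (hG : (G y).IsInvertible)
    {T : E →L[ℝ] E →L[ℝ] ℝ} {l : ℝ}
    (h : ∀ X Y Z W, kulkarniNomizu T (G y) X Y Z W + riemann G y X Y Z W =
      l * ((1 / 2) * kulkarniNomizu (G y) (G y) X Y Z W)) :
    ricci G y = (l * (Module.finrank ℝ E - 1) - metricTrace (G y) T) • G y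
      - (Module.finrank ℝ E - 2 : ℝ) • T := by
  ext Y Z
  have curvature_eq : curvature G y Y Z = (l * G y Y Z - T Y Z) • (1 : E →ₗ[ℝ] E)
      - G y Y Z • (sharp (G y) ∘L T).toLinearMap
      + (T.flip Z).toLinearMap.smulRight Y
      + ((G y).flip Z).toLinearMap.smulRight (sharp (G y) (T Y) - l • Y) := by
    ext X
    refine eq_of_forall_apply_eq hG fun W ↦ ?_
    have hXW := h X Y Z W
    simp only [kulkarniNomizu, riemann] at hXW
    simp only [LinearMap.add_apply, LinearMap.sub_apply, LinearMap.smul_apply, Module.End.one_apply,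
      LinearMap.smulRight_apply, ContinuousLinearMap.coe_coe, ContinuousLinearMap.comp_apply,
      ContinuousLinearMap.flip_apply, map_add, map_sub, map_smul, apply_sharp hG, add_apply,
      sub_apply, smul_apply, smul_eq_mul]
    linear_combination hXW
  rw [ricci_apply, curvature_eq]
  simp only [map_add, map_sub, map_smul, LinearMap.trace_one, LinearMap.trace_smulRight,
    ← show metricTrace (G y) T = LinearMap.trace ℝ E (sharp (G y) ∘L T).toLinearMap from rfl]
  simp only [ContinuousLinearMap.coe_coe, ContinuousLinearMap.flip_apply, apply_sharp hG,
    sub_apply, smul_apply, smul_eq_mul]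
  ring

/-- `G` is a pseudo-Riemannian metric of class `C²` on the open set `U`. Nondegeneracy is
expressed as invertibility of `v ↦ G(v, ·)`. -/
structure IsPseudoRiemannianOn (U : Set E) (G : E → E →L[ℝ] E →L[ℝ] ℝ) : Prop where
  isOpen : IsOpen U
  contDiffOn : ContDiffOn ℝ 2 G U
  symm : ∀ y ∈ U, ∀ u v, G y u v = G y v u
  isInvertible : ∀ y ∈ U, (G y).IsInvertible

namespace IsPseudoRiemannianOn

theorem contDiffAt (hG : IsPseudoRiemannianOn U G) (hy : y ∈ U) : ContDiffAt ℝ 2 G y :=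
  hG.contDiffOn.contDiffAt (hG.isOpen.mem_nhds hy)

theorem differentiableAt (hG : IsPseudoRiemannianOn U G) (hy : y ∈ U) : DifferentiableAt ℝ G y :=
  (hG.contDiffAt hy).differentiableAt (by simp)

theorem fderiv_symm (hG : IsPseudoRiemannianOn U G) (hy : y ∈ U) (u v w : E) :
    fderiv ℝ G y u v w = fderiv ℝ G y u w v := by
  rw [← fderiv_apply_apply_const (hG.differentiableAt hy),
    ← fderiv_apply_apply_const (hG.differentiableAt hy)]
  congr 1
  refine Filter.EventuallyEq.fderiv_eq ?_
  filter_upwards [hG.isOpen.mem_nhds hy] with z hz using hG.symm z hz v w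

theorem apply_christoffel (hG : IsPseudoRiemannianOn U G) (hy : y ∈ U) (u v w : E) :
    G y (christoffel G y u v) w =
      (1 / 2) * (fderiv ℝ G y u v w + fderiv ℝ G y v u w - fderiv ℝ G y w u v) := by
  simp [christoffel, apply_sharp (hG.isInvertible y hy), ContinuousLinearMap.compL_apply]

theorem christoffel_symm (hG : IsPseudoRiemannianOn U G) (hy : y ∈ U) (u v : E) :
    christoffel G y u v = christoffel G y v u := by
  refine eq_of_forall_apply_eq (hG.isInvertible y hy) fun w ↦ ?_
  rw [hG.apply_christoffel hy, hG.apply_christoffel hy, hG.fderiv_symm hy w u v]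
  ring

theorem fderiv_eq_christoffel (hG : IsPseudoRiemannianOn U G) (hy : y ∈ U) (u v w : E) :
    fderiv ℝ G y u v w = G y (christoffel G y u v) w + G y v (christoffel G y u w) := by
  rw [hG.symm y hy v, hG.apply_christoffel hy, hG.apply_christoffel hy, hG.fderiv_symm hy u w v,
    hG.fderiv_symm hy v u w]
  ring

theorem fderiv_metric_apply (hG : IsPseudoRiemannianOn U G) (hy : y ∈ U) {X Y : E → E}
    (hX : DifferentiableAt ℝ X y) (hY : DifferentiableAt ℝ Y y) (u : E) :
    fderiv ℝ (fun z ↦ G z (X z) (Y z)) y u =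
      G y (covDeriv G X y u) (Y y) + G y (X y) (covDeriv G Y y u) := by
  have hG' := hG.differentiableAt hy
  rw [fderiv_apply_eq (hG'.clm_apply hX) hY, fderiv_apply_eq hG' hX, add_apply,
    hG.fderiv_eq_christoffel hy, covDeriv_apply, covDeriv_apply, map_add, map_add, add_apply]
  ring

theorem apply_covDeriv_self_of_unit (hG : IsPseudoRiemannianOn U G) (hy : y ∈ U) {X : E → E}
    (hX : DifferentiableAt ℝ X y) (hunit : ∀ z ∈ U, G z (X z) (X z) = 1) (u : E) :
    G y (X y) (covDeriv G X y u) = 0 := by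
  have hconst : (fun z ↦ G z (X z) (X z)) =ᶠ[nhds y] fun _ ↦ (1 : ℝ) := by
    filter_upwards [hG.isOpen.mem_nhds hy] with z hz using hunit z hz
  have h := hG.fderiv_metric_apply hy hX hX u
  rw [hconst.fderiv_eq, fderiv_fun_const, Pi.zero_apply, zero_apply,
    hG.symm y hy (covDeriv G X y u)] at h
  linear_combination -h / 2

set_option maxSynthPendingDepth 5 in
theorem differentiableAt_christoffel [CompleteSpace E] (hG : IsPseudoRiemannianOn U G)
    (hy : y ∈ U) : DifferentiableAt ℝ (christoffel G) y := by
  have hsharp : DifferentiableAt ℝ (fun z ↦ sharp (G z)) y :=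
    (((hG.isInvertible y hy).contDiffAt_map_inverse (n := 2)).comp y
      (hG.contDiffAt hy)).differentiableAt (by simp)
  have hcomp : DifferentiableAt ℝ
      (fun z ↦ ContinuousLinearMap.compL ℝ E (E →L[ℝ] ℝ) E (sharp (G z))) y :=
    (ContinuousLinearMap.compL ℝ E (E →L[ℝ] ℝ) E).differentiableAt.comp y hsharp
  have hfderiv : DifferentiableAt ℝ (fderiv ℝ G) y :=
    ((hG.contDiffAt hy).fderiv_right (m := 1) le_rfl).differentiableAt (by simp)
  have hflip : DifferentiableAt ℝ (fun z ↦ (fderiv ℝ G z).flip) y :=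
    (ContinuousLinearMap.flipₗᵢ ℝ E E (E →L[ℝ] ℝ)).differentiableAt.comp y hfderiv
  exact (((hcomp.clm_comp hfderiv).add (hcomp.clm_comp hflip)).sub
    (hcomp.clm_comp ((differentiableAt_const _).clm_comp hflip))).const_smul (1 / 2 : ℝ)

theorem hessian_symm (hG : IsPseudoRiemannianOn U G) (hy : y ∈ U) {F : E → ℝ}
    (hF : ContDiffAt ℝ 2 F y) (u v : E) : hessian G F y u v = hessian G F y v u := by
  have hF_symm : IsSymmSndFDerivAt ℝ F y := hF.isSymmSndFDerivAt (by simp)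
  simp [hessian, hF_symm.eq u v, hG.christoffel_symm hy u v]

theorem lieDerivMetric_apply (hG : IsPseudoRiemannianOn U G) (hy : y ∈ U) (V : E → E) (u w : E) :
    lieDerivMetric G V y u w = G y (covDeriv G V y u) w + G y u (covDeriv G V y w) := by
  simp only [lieDerivMetric, add_apply, ContinuousLinearMap.comp_apply,
    ContinuousLinearMap.flip_apply, covDeriv_apply, map_add, hG.fderiv_eq_christoffel hy,
    hG.christoffel_symm hy (V y)]
  ring

theorem hessian_apply_of_gradient (hG : IsPseudoRiemannianOn U G) (hy : y ∈ U) {V : E → E}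
    {F : E → ℝ} (hV : DifferentiableAt ℝ V y) (hVF : ∀ z ∈ U, G z (V z) = fderiv ℝ F z) (u w : E) :
    hessian G F y u w = G y (covDeriv G V y u) w := by
  have hF : fderiv ℝ F =ᶠ[nhds y] fun z ↦ G z (V z) := by
    filter_upwards [hG.isOpen.mem_nhds hy] with z hz using (hVF z hz).symm
  simp only [hessian, sub_apply, ContinuousLinearMap.comp_apply, ContinuousLinearMap.compL_apply,
    hF.fderiv_eq, fderiv_apply_eq (hG.differentiableAt hy) hV, ← hVF y hy, covDeriv_apply,
    add_apply, map_add, hG.fderiv_eq_christoffel hy]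
  ring

theorem lieDerivMetric_of_gradient (hG : IsPseudoRiemannianOn U G) (hy : y ∈ U) {V : E → E}
    {F : E → ℝ} (hV : DifferentiableAt ℝ V y) (hF : ContDiffAt ℝ 2 F y)
    (hVF : ∀ z ∈ U, G z (V z) = fderiv ℝ F z) :
    lieDerivMetric G V y = (2 : ℝ) • hessian G F y := by
  ext u w
  rw [hG.lieDerivMetric_apply hy, hG.symm y hy u, ← hG.hessian_apply_of_gradient hy hV hVF,
    ← hG.hessian_apply_of_gradient hy hV hVF, hG.hessian_symm hy hF w u, smul_apply, smul_apply,
    smul_eq_mul, two_mul]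

theorem exists_ricci_eq_of_gradient_soliton [FiniteDimensional ℝ E]
    (hG : IsPseudoRiemannianOn U G) (hy : y ∈ U) {F : E → ℝ} (hF : ContDiffAt ℝ 2 F y) {V : E → E}
    (hV : DifferentiableAt ℝ V y) (hVF : ∀ z ∈ U, G z (V z) = fderiv ℝ F z) {l : ℝ}
    (hsol : ∀ X Y Z W, (1 / 2) * kulkarniNomizu (lieDerivMetric G V y) (G y) X Y Z W
      + riemann G y X Y Z W = l * ((1 / 2) * kulkarniNomizu (G y) (G y) X Y Z W)) :
    ∃ s : ℝ, ricci G y = s • G y - (Module.finrank ℝ E - 2 : ℝ) • hessian G F y := by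
  refine ⟨_, ricci_eq_of_kulkarniNomizu (l := l) (hG.isInvertible y hy) fun X Y Z W ↦ ?_⟩
  rw [← hsol, hG.lieDerivMetric_of_gradient hy hV hF hVF]
  simp only [kulkarniNomizu, smul_apply, smul_eq_mul]
  ring

end IsPseudoRiemannianOn

/-- `Ξ` is a unit vector field of class `C²` on `U`, with metrically dual form `η`, such that
`∇_u Ξ = u - η(u) Ξ`; such fields are called torse-forming. The Reeb field of a Kenmotsu
manifold has this property. -/
structure IsUnitTorseFormingOn (U : Set E) (G : E → E →L[ℝ] E →L[ℝ] ℝ) (Ξ : E → E)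
    (η : E → E →L[ℝ] ℝ) : Prop extends IsPseudoRiemannianOn U G where
  contDiffOn_field : ContDiffOn ℝ 2 Ξ U
  form_eq : ∀ y ∈ U, η y = G y (Ξ y)
  form_field : ∀ y ∈ U, η y (Ξ y) = 1
  covDeriv_field : ∀ y ∈ U, ∀ u, covDeriv G Ξ y u = u - η y u • Ξ y

/-- The deformation `a G + a (a - 1) η ⊗ η` of the metric `G`. -/
noncomputable def deform (G : E → E →L[ℝ] E →L[ℝ] ℝ) (η : E → E →L[ℝ] ℝ) (a : ℝ) (y : E) :
    E →L[ℝ] E →L[ℝ] ℝ :=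
  a • G y + (a * (a - 1)) • (η y).smulRight (η y)

theorem deform_apply (G : E → E →L[ℝ] E →L[ℝ] ℝ) (η : E → E →L[ℝ] ℝ) (a : ℝ) (y u v : E) :
    deform G η a y u v = a * G y u v + a * (a - 1) * (η y u * η y v) := by
  simp [deform]

namespace IsUnitTorseFormingOn

variable {Ξ : E → E} {η : E → E →L[ℝ] ℝ} {a : ℝ}

theorem metric_field_field (h : IsUnitTorseFormingOn U G Ξ η) (hy : y ∈ U) :
    G y (Ξ y) (Ξ y) = 1 := by
  rw [← h.form_eq y hy, h.form_field y hy]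

theorem nontrivial (h : IsUnitTorseFormingOn U G Ξ η) (hy : y ∈ U) : Nontrivial E :=
  nontrivial_of_ne (Ξ y) 0 fun h₀ ↦ by simpa [h₀] using h.form_field y hy

theorem contDiffAt_field (h : IsUnitTorseFormingOn U G Ξ η) (hy : y ∈ U) : ContDiffAt ℝ 2 Ξ y :=
  h.contDiffOn_field.contDiffAt (h.isOpen.mem_nhds hy)

theorem differentiableAt_field (h : IsUnitTorseFormingOn U G Ξ η) (hy : y ∈ U) :
    DifferentiableAt ℝ Ξ y :=
  (h.contDiffAt_field hy).differentiableAt (by simp)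

theorem contDiffOn_form (h : IsUnitTorseFormingOn U G Ξ η) : ContDiffOn ℝ 2 η U :=
  (h.contDiffOn.clm_apply h.contDiffOn_field).congr h.form_eq

theorem differentiableAt_form (h : IsUnitTorseFormingOn U G Ξ η) (hy : y ∈ U) :
    DifferentiableAt ℝ η y :=
  (h.contDiffOn_form.contDiffAt (h.isOpen.mem_nhds hy)).differentiableAt (by simp)

theorem fderiv_field (h : IsUnitTorseFormingOn U G Ξ η) (hy : y ∈ U) (u : E) :
    fderiv ℝ Ξ y u = u - η y u • Ξ y - christoffel G y u (Ξ y) := by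
  rw [← h.covDeriv_field y hy, covDeriv_apply, add_sub_cancel_right]

theorem fderiv_form (h : IsUnitTorseFormingOn U G Ξ η) (hy : y ∈ U) (u v : E) :
    fderiv ℝ η y u v = G y u v - η y u * η y v + η y (christoffel G y u v) := by
  have hη : (fun z ↦ η z v) =ᶠ[nhds y] fun z ↦ G z (Ξ z) v := by
    filter_upwards [h.isOpen.mem_nhds hy] with z hz using by rw [h.form_eq z hz]
  rw [← fderiv_apply_const (h.differentiableAt_form hy), hη.fderiv_eq,
    h.fderiv_metric_apply hy (h.differentiableAt_field hy) (differentiableAt_const v),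
    h.covDeriv_field y hy, ← h.form_eq y hy]
  simp [covDeriv_apply, h.form_eq y hy]

theorem fderiv_form_symm (h : IsUnitTorseFormingOn U G Ξ η) (hy : y ∈ U) (u v : E) :
    fderiv ℝ η y u v = fderiv ℝ η y v u := by
  rw [h.fderiv_form hy, h.fderiv_form hy, h.symm y hy, h.christoffel_symm hy]
  ring

theorem curvature_field [CompleteSpace E] (h : IsUnitTorseFormingOn U G Ξ η) (hy : y ∈ U)
    (u v : E) : curvature G y v (Ξ y) u = η y u • v - η y v • u := by
  have hη := h.differentiableAt_form hy
  have second_covDeriv (u v : E) : covDeriv G (fun z ↦ covDeriv G Ξ z v) y u =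
      christoffel G y u v - fderiv ℝ η y u v • Ξ y - η y v • (u - η y u • Ξ y) := by
    have hcov : (fun z ↦ covDeriv G Ξ z v) =ᶠ[nhds y] fun z ↦ v - η z v • Ξ z := by
      filter_upwards [h.isOpen.mem_nhds hy] with z hz using h.covDeriv_field z hz v
    rw [covDeriv_apply, hcov.fderiv_eq, h.covDeriv_field y hy, fderiv_const_sub,
      fderiv_fun_smul (by fun_prop) (h.differentiableAt_field hy)]
    simp only [neg_apply, add_apply, smul_apply, ContinuousLinearMap.smulRight_apply,
      fderiv_apply_const hη, h.fderiv_field hy, map_sub, map_smul]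
    module
  rw [curvature_apply_field (h.differentiableAt_christoffel hy) (h.contDiffAt_field hy),
    second_covDeriv, second_covDeriv, h.fderiv_form_symm hy u v, h.christoffel_symm hy u v]
  module

theorem ricci_field_field [FiniteDimensional ℝ E] (h : IsUnitTorseFormingOn U G Ξ η)
    (hy : y ∈ U) : ricci G y (Ξ y) (Ξ y) = 1 - Module.finrank ℝ E := by
  have curvature_eq : curvature G y (Ξ y) (Ξ y) = (η y).toLinearMap.smulRight (Ξ y) - 1 := by
    ext u
    simp [h.curvature_field hy, h.form_field y hy]
  rw [ricci_apply, curvature_eq, map_sub, LinearMap.trace_smulRight, LinearMap.trace_one]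
  simp [h.form_field y hy]

theorem hessian_field_field (h : IsUnitTorseFormingOn U G Ξ η) (hy : y ∈ U) {F : E → ℝ}
    (hF : ContDiffAt ℝ 2 F y) :
    hessian G F y (Ξ y) (Ξ y) = fderiv ℝ (fun z ↦ fderiv ℝ F z (Ξ z)) y (Ξ y) := by
  rw [fderiv_fderiv_apply_field G hF (h.differentiableAt_field hy), h.covDeriv_field y hy,
    h.form_field y hy, one_smul, sub_self, map_zero, add_zero]

theorem isPseudoRiemannianOn_deform (h : IsUnitTorseFormingOn U G Ξ η) (ha : a ≠ 0) :
    IsPseudoRiemannianOn U (deform G η a) where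
  isOpen := h.isOpen
  contDiffOn := (h.contDiffOn.const_smul a).add
    ((h.contDiffOn_form.smulRight h.contDiffOn_form).const_smul _)
  symm y hy u v := by
    rw [deform_apply, deform_apply, h.symm y hy]
    ring
  isInvertible y hy := by
    rw [deform, h.form_eq y hy]
    refine isInvertible_smul_add_smulRight (h.isInvertible y hy) (fun u ↦ h.symm y hy u _) ha ?_
    rw [h.metric_field_field hy, mul_one, ← mul_one_add, add_sub_cancel]
    exact mul_ne_zero ha ha

theorem fderiv_deform (h : IsUnitTorseFormingOn U G Ξ η) (ha : a ≠ 0) (hy : y ∈ U) (u v w : E) :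
    fderiv ℝ (deform G η a) y u v w = a * fderiv ℝ G y u v w +
      a * (a - 1) * (fderiv ℝ η y u v * η y w + η y v * fderiv ℝ η y u w) := by
  have hG := h.differentiableAt hy
  have hη := h.differentiableAt_form hy
  rw [← fderiv_apply_apply_const ((h.isPseudoRiemannianOn_deform ha).differentiableAt hy)]
  simp only [deform_apply]
  rw [fderiv_fun_add (by fun_prop) (by fun_prop), fderiv_const_mul (by fun_prop),
    fderiv_const_mul (by fun_prop), fderiv_fun_mul (by fun_prop) (by fun_prop)]
  simp only [add_apply, smul_apply, fderiv_apply_apply_const hG, fderiv_apply_const hη, smul_eq_mul]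
  ring

theorem christoffel_deform (h : IsUnitTorseFormingOn U G Ξ η) (ha : a ≠ 0) (hy : y ∈ U)
    (u v : E) :
    christoffel (deform G η a) y u v =
      christoffel G y u v + ((a - 1) / a * (G y u v - η y u * η y v)) • Ξ y := by
  have hG' := h.isPseudoRiemannianOn_deform ha
  refine eq_of_forall_apply_eq (hG'.isInvertible y hy) fun w ↦ ?_
  have hΓ := h.apply_christoffel hy u v w
  have hη := h.fderiv_form hy u v
  rw [hG'.apply_christoffel hy, h.fderiv_deform ha hy, h.fderiv_deform ha hy,
    h.fderiv_deform ha hy, deform_apply, h.fderiv_form_symm hy v u, h.fderiv_form_symm hy w u,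
    h.fderiv_form_symm hy w v]
  simp only [map_add, map_smul, add_apply, smul_apply, smul_eq_mul, h.form_field y hy,
    ← h.form_eq y hy]
  have hk : (a - 1) / a * a = a - 1 := by field_simp
  linear_combination a * (a - 1) * η y w * hη - a * hΓ -
    a * (G y u v - η y u * η y v) * η y w * hk

theorem fderiv_christoffel_deform [CompleteSpace E] (h : IsUnitTorseFormingOn U G Ξ η)
    (ha : a ≠ 0) (hy : y ∈ U) (u v w : E) :
    fderiv ℝ (christoffel (deform G η a)) y u v w = fderiv ℝ (christoffel G) y u v w +
      (((a - 1) / a) * (fderiv ℝ G y u v w - fderiv ℝ η y u v * η y w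
        - η y v * fderiv ℝ η y u w)) • Ξ y
      + ((a - 1) / a * (G y v w - η y v * η y w)) • fderiv ℝ Ξ y u := by
  have hG := h.differentiableAt hy
  have hη := h.differentiableAt_form hy
  have hΓ := h.differentiableAt_christoffel hy
  have hΞ := h.differentiableAt_field hy
  have hdeform : (fun z ↦ christoffel (deform G η a) z v w) =ᶠ[nhds y]
      fun z ↦ christoffel G z v w + ((a - 1) / a * (G z v w - η z v * η z w)) • Ξ z := by
    filter_upwards [h.isOpen.mem_nhds hy] with z hz using h.christoffel_deform ha hz v w
  rw [← fderiv_apply_apply_const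
      ((h.isPseudoRiemannianOn_deform ha).differentiableAt_christoffel hy),
    hdeform.fderiv_eq, fderiv_fun_add (by fun_prop) (by fun_prop), fderiv_fun_smul (by fun_prop) hΞ,
    fderiv_const_mul (by fun_prop), fderiv_fun_sub (by fun_prop) (by fun_prop),
    fderiv_fun_mul (by fun_prop) (by fun_prop)]
  simp only [add_apply, sub_apply, smul_apply, ContinuousLinearMap.smulRight_apply,
    fderiv_apply_apply_const hG, fderiv_apply_apply_const hΓ, fderiv_apply_const hη, smul_eq_mul]
  module

theorem curvature_deform [CompleteSpace E] (h : IsUnitTorseFormingOn U G Ξ η) (ha : a ≠ 0)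
    (hy : y ∈ U) (u v w : E) :
    curvature (deform G η a) y v w u = curvature G y v w u +
      ((a - 1) / a) • ((G y v w - η y v * η y w) • u - (G y u w - η y u * η y w) • v) := by
  rw [curvature_apply, curvature_apply, h.fderiv_christoffel_deform ha hy,
    h.fderiv_christoffel_deform ha hy, h.fderiv_form_symm hy v u]
  simp only [h.christoffel_deform ha hy, h.fderiv_eq_christoffel hy, h.fderiv_form hy,
    h.fderiv_field hy, map_add, map_smul, ← h.form_eq y hy, h.form_field y hy, h.symm y hy _ (Ξ y),
    smul_eq_mul]
  rw [h.christoffel_symm hy v u]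
  module

theorem ricci_deform [FiniteDimensional ℝ E] (h : IsUnitTorseFormingOn U G Ξ η) (ha : a ≠ 0)
    (hy : y ∈ U) (v w : E) :
    ricci (deform G η a) y v w = ricci G y v w +
      (Module.finrank ℝ E - 1) * ((a - 1) / a) * (G y v w - η y v * η y w) := by
  have curvature_eq : curvature (deform G η a) y v w = curvature G y v w +
      ((a - 1) / a) • ((G y v w - η y v * η y w) • (1 : E →ₗ[ℝ] E)
        - ((G y).flip w - η y w • η y).toLinearMap.smulRight v) := by
    ext u
    rw [h.curvature_deform ha hy]
    simp [mul_comm]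
  rw [ricci_apply, ricci_apply, curvature_eq]
  simp only [map_add, map_sub, map_smul, LinearMap.trace_one, LinearMap.trace_smulRight]
  simp only [ContinuousLinearMap.coe_coe, ContinuousLinearMap.flip_apply, sub_apply, smul_apply,
    smul_eq_mul]
  ring

theorem hessian_deform (h : IsUnitTorseFormingOn U G Ξ η) (ha : a ≠ 0) (hy : y ∈ U) (F : E → ℝ)
    (v w : E) :
    hessian (deform G η a) F y v w = hessian G F y v w -
      ((a - 1) / a) * fderiv ℝ F y (Ξ y) * (G y v w - η y v * η y w) := by
  simp only [hessian, sub_apply, ContinuousLinearMap.comp_apply, ContinuousLinearMap.compL_apply,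
    h.christoffel_deform ha hy, map_add, map_smul, smul_eq_mul]
  ring

theorem ricci_eq_of_ricci_deform_eq [FiniteDimensional ℝ E] (h : IsUnitTorseFormingOn U G Ξ η)
    (ha : a ≠ 0) (hy : y ∈ U) {F : E → ℝ} {s : ℝ}
    (hs : ricci (deform G η a) y =
      s • deform G η a y - (Module.finrank ℝ E - 2 : ℝ) • hessian (deform G η a) F y) :
    ∃ r : ℝ, ricci G y = (-(Module.finrank ℝ E - 2) : ℝ) • (hessian G F y + ((a - 1) / a *
      (fderiv ℝ F y (Ξ y) - hessian G F y (Ξ y) (Ξ y))) • (G y (Ξ y)).smulRight (G y (Ξ y)))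
      + r • G y := by
  set N : ℝ := ((Module.finrank ℝ E : ℕ) : ℝ)
  have ricci_eq (v w : E) : ricci G y v w + (N - 1) * ((a - 1) / a) * (G y v w - η y v * η y w) =
      s * (a * G y v w + a * (a - 1) * (η y v * η y w)) - (N - 2) * (hessian G F y v w -
        (a - 1) / a * fderiv ℝ F y (Ξ y) * (G y v w - η y v * η y w)) := by
    rw [← h.ricci_deform ha hy, hs, sub_apply, sub_apply, smul_apply, smul_apply, smul_apply,
      smul_apply, deform_apply, h.hessian_deform ha hy, smul_eq_mul, smul_eq_mul]
  -- Evaluation at `(Ξ, Ξ)` determines the factor `s`, because `Ric(Ξ, Ξ)` is known.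
  have factor_eq : s = ((N - 2) * hessian G F y (Ξ y) (Ξ y) - (N - 1)) / a ^ 2 := by
    have hΞΞ := ricci_eq (Ξ y) (Ξ y)
    rw [h.ricci_field_field hy, h.metric_field_field hy, h.form_field y hy] at hΞΞ
    field_simp
    linear_combination -hΞΞ
  refine ⟨(N - 2) * ((a - 1) / a * (fderiv ℝ F y (Ξ y) - hessian G F y (Ξ y) (Ξ y)) +
    hessian G F y (Ξ y) (Ξ y)) - (N - 1), ?_⟩
  ext v w
  simp only [add_apply, smul_apply, ContinuousLinearMap.smulRight_apply, smul_eq_mul,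
    ← h.form_eq y hy]
  rw [eq_sub_of_add_eq (ricci_eq v w), factor_eq]
  field_simp
  ring

end IsUnitTorseFormingOn

theorem IsPseudoRiemannianOn.covDeriv_eq_of_covDerivEndo {Φ : E → E →L[ℝ] E} {Ξ : E → E}
    (hG : IsPseudoRiemannianOn U G) (hy : y ∈ U) (hΦ : DifferentiableAt ℝ Φ y)
    (hΞ : DifferentiableAt ℝ Ξ y) (hunit : ∀ z ∈ U, G z (Ξ z) (Ξ z) = 1)
    (endo_field : ∀ z ∈ U, Φ z (Ξ z) = 0) (endo_endo : ∀ v, Φ y (Φ y v) = -v + G y (Ξ y) v • Ξ y)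
    (covDerivEndo_field : ∀ u, covDerivEndo G Φ y u (Ξ y) = -Φ y u) (u : E) :
    covDeriv G Ξ y u = u - G y (Ξ y) u • Ξ y := by
  have endo_covDeriv : Φ y (covDeriv G Ξ y u) = Φ y u := by
    have hzero : (fun z ↦ Φ z (Ξ z)) =ᶠ[nhds y] fun _ ↦ 0 := by
      filter_upwards [hG.isOpen.mem_nhds hy] with z hz using endo_field z hz
    have hcov := covDerivEndo_apply_field G hΦ hΞ u
    rw [covDerivEndo_field, covDeriv_apply, hzero.fderiv_eq, endo_field y hy] at hcov
    simpa using hcov.symm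
  have h := congrArg (Φ y) endo_covDeriv
  rw [endo_endo, endo_endo, hG.apply_covDeriv_self_of_unit hy hΞ hunit, zero_smul, add_zero] at h
  rw [← neg_inj, h]
  abel

end Coord

section Chart

variable {E : Type*} [NormedAddCommGroup E] [NormedSpace ℝ E]
  {M : Type*} [TopologicalSpace M] [ChartedSpace E M]

theorem fieldIn_apply (c : OpenPartialHomeomorph M E) (X : Π x : M, TangentSpace 𝓘(ℝ, E) x)
    (y : E) : fieldIn c X y = chartDeriv c (c.symm y) (X (c.symm y)) := rfl

theorem formIn_apply (c : OpenPartialHomeomorph M E)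
    (α : Π x : M, TangentSpace 𝓘(ℝ, E) x →L[ℝ] ℝ) (y v : E) :
    formIn c α y v = α (c.symm y) (chartSymmDeriv c y v) := rfl

theorem endoIn_apply (c : OpenPartialHomeomorph M E)
    (Φ : Π x : M, TangentSpace 𝓘(ℝ, E) x →L[ℝ] TangentSpace 𝓘(ℝ, E) x) (y v : E) :
    endoIn c Φ y v = chartDeriv c (c.symm y) (Φ (c.symm y) (chartSymmDeriv c y v)) := rfl

theorem bilinIn_apply (c : OpenPartialHomeomorph M E)
    (A : Π x : M, TangentSpace 𝓘(ℝ, E) x →L[ℝ] TangentSpace 𝓘(ℝ, E) x →L[ℝ] ℝ) (y u v : E) :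
    bilinIn c A y u v = A (c.symm y) (chartSymmDeriv c y u) (chartSymmDeriv c y v) := rfl

section MDifferentiable

variable {c : OpenPartialHomeomorph M E} {y : E} {f : M → ℝ}
  {g : Π x : M, TangentSpace 𝓘(ℝ, E) x →L[ℝ] TangentSpace 𝓘(ℝ, E) x →L[ℝ] ℝ}

theorem chartDeriv_chartSymmDeriv (hc : c.MDifferentiable 𝓘(ℝ, E) 𝓘(ℝ, E)) (hy : y ∈ c.target)
    (v : E) : chartDeriv c (c.symm y) (chartSymmDeriv c y v) = v :=
  DFunLike.congr_fun (hc.comp_symm_deriv hy) v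

theorem chartSymmDeriv_chartDeriv (hc : c.MDifferentiable 𝓘(ℝ, E) 𝓘(ℝ, E)) (hy : y ∈ c.target)
    (v : TangentSpace 𝓘(ℝ, E) (c.symm y)) :
    chartSymmDeriv c y (chartDeriv c (c.symm y) v) = v := by
  have h := hc.symm_comp_deriv (c.map_target hy)
  rw [c.right_inv hy] at h
  exact DFunLike.congr_fun h v

theorem mfderiv_chartSymmDeriv (hc : c.MDifferentiable 𝓘(ℝ, E) 𝓘(ℝ, E)) (hy : y ∈ c.target)
    (hf : MDifferentiableAt 𝓘(ℝ, E) 𝓘(ℝ, ℝ) f (c.symm y)) (v : E) :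
    mfderiv 𝓘(ℝ, E) 𝓘(ℝ, ℝ) f (c.symm y) (chartSymmDeriv c y v) = fderiv ℝ (f ∘ c.symm) y v := by
  have h := mfderiv_comp y hf (hc.mdifferentiableAt_symm hy)
  rw [mfderiv_eq_fderiv] at h
  exact (DFunLike.congr_fun h v).symm

theorem dirDeriv_symm (hc : c.MDifferentiable 𝓘(ℝ, E) 𝓘(ℝ, E)) (hy : y ∈ c.target)
    (hf : MDifferentiableAt 𝓘(ℝ, E) 𝓘(ℝ, ℝ) f (c.symm y)) (X : Π x : M, TangentSpace 𝓘(ℝ, E) x) :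
    dirDeriv X f (c.symm y) = fderiv ℝ (f ∘ c.symm) y (fieldIn c X y) := by
  rw [← mfderiv_chartSymmDeriv hc hy hf, fieldIn_apply, chartSymmDeriv_chartDeriv hc hy, dirDeriv]

theorem isInvertible_of_isInvertible_bilinIn (hc : c.MDifferentiable 𝓘(ℝ, E) 𝓘(ℝ, E))
    (hy : y ∈ c.target) (hg : (bilinIn c g y).IsInvertible) : (g (c.symm y)).IsInvertible := by
  let D : E ≃L[ℝ] TangentSpace 𝓘(ℝ, E) (c.symm y) :=
    .equivOfInverse (chartSymmDeriv c y) (chartDeriv c (c.symm y))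
      (chartDeriv_chartSymmDeriv hc hy) (chartSymmDeriv_chartDeriv hc hy)
  have hD : bilinIn c g y =
      (D.symm.arrowCongr (.refl ℝ ℝ)).toContinuousLinearMap ∘L g (c.symm y) ∘L
        D.toContinuousLinearMap := rfl
  rwa [hD, ContinuousLinearMap.isInvertible_equiv_comp,
    ContinuousLinearMap.isInvertible_comp_equiv] at hg

theorem bilinIn_fieldIn_grad (hc : c.MDifferentiable 𝓘(ℝ, E) 𝓘(ℝ, E)) (hy : y ∈ c.target)
    (hg : (bilinIn c g y).IsInvertible) (hf : MDifferentiableAt 𝓘(ℝ, E) 𝓘(ℝ, ℝ) f (c.symm y)) :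
    bilinIn c g y (fieldIn c (grad g f) y) = fderiv ℝ (f ∘ c.symm) y := by
  ext v
  rw [bilinIn_apply, fieldIn_apply, chartSymmDeriv_chartDeriv hc hy,
    ← mfderiv_chartSymmDeriv hc hy hf]
  exact DFunLike.congr_fun (apply_sharp (isInvertible_of_isInvertible_bilinIn hc hy hg) _) _

theorem mdifferentiableAt_symm_of_comp_symm (hc : c.MDifferentiable 𝓘(ℝ, E) 𝓘(ℝ, E))
    (hy : y ∈ c.target) (hf : DifferentiableAt ℝ (f ∘ c.symm) y) :
    MDifferentiableAt 𝓘(ℝ, E) 𝓘(ℝ, ℝ) f (c.symm y) := by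
  have hcy := c.map_target hy
  rw [← c.right_inv hy] at hf
  refine (hf.mdifferentiableAt.comp _ (hc.mdifferentiableAt hcy)).congr_of_eventuallyEq ?_
  filter_upwards [c.open_source.mem_nhds hcy] with z hz
  simp [c.left_inv hz]

end MDifferentiable

section Smooth

variable [IsManifold 𝓘(ℝ, E) ∞ M] {x₀ : M} {y : E}

theorem mdifferentiable_chartAt (x₀ : M) : (chartAt E x₀).MDifferentiable 𝓘(ℝ, E) 𝓘(ℝ, E) :=
  haveI : IsManifold 𝓘(ℝ, E) 1 M := .of_le (n := ∞) (by exact_mod_cast le_top)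
  mdifferentiable_of_mem_atlas (chart_mem_atlas E x₀)

theorem continuousLinearMapAt_eq_chartDeriv {x : M} (hx : x ∈ (chartAt E x₀).source)
    (v : TangentSpace 𝓘(ℝ, E) x) :
    (trivializationAt E (TangentSpace 𝓘(ℝ, E) (M := M)) x₀).continuousLinearMapAt ℝ x v =
      chartDeriv (chartAt E x₀) x v :=
  haveI : IsManifold 𝓘(ℝ, E) 1 M := .of_le (n := ∞) (by exact_mod_cast le_top)
  DFunLike.congr_fun (TangentBundle.continuousLinearMapAt_trivializationAt (I := 𝓘(ℝ, E)) hx) v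

theorem symmL_eq_chartSymmDeriv (hy : y ∈ (chartAt E x₀).target) (v : E) :
    (trivializationAt E (TangentSpace 𝓘(ℝ, E) (M := M)) x₀).symmL ℝ ((chartAt E x₀).symm y) v =
      chartSymmDeriv (chartAt E x₀) y v := by
  have hs := (chartAt E x₀).map_target hy
  rw [← chartSymmDeriv_chartDeriv (mdifferentiable_chartAt x₀) hy
    ((trivializationAt E (TangentSpace 𝓘(ℝ, E) (M := M)) x₀).symmL ℝ ((chartAt E x₀).symm y) v),
    ← continuousLinearMapAt_eq_chartDeriv hs,
    (trivializationAt E (TangentSpace 𝓘(ℝ, E) (M := M)) x₀).continuousLinearMapAt_symmL hs]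

theorem contMDiffOn_symmL (v : E) :
    ContMDiffOn 𝓘(ℝ, E) (𝓘(ℝ, E).prod 𝓘(ℝ, E)) ∞
      (fun x ↦ Bundle.TotalSpace.mk' E (E := fun x : M ↦ TangentSpace 𝓘(ℝ, E) x) x
        ((trivializationAt E (TangentSpace 𝓘(ℝ, E) (M := M)) x₀).symmL ℝ x v))
      (chartAt E x₀).source := by
  let e := trivializationAt E (TangentSpace 𝓘(ℝ, E) (M := M)) x₀
  have hb : e.baseSet = (chartAt E x₀).source := rfl
  rw [← hb, e.contMDiffOn_section_baseSet_iff]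
  refine (contMDiffOn_const (c := v)).congr fun x hx ↦ ?_
  have h := e.continuousLinearMapAt_symmL (R := ℝ) hx v
  rwa [Bundle.Trivialization.continuousLinearMapAt_apply, e.linearMapAt_apply, if_pos hx] at h

theorem contDiffOn_comp_symm {f : M → ℝ}
    (hf : ContMDiffOn 𝓘(ℝ, E) 𝓘(ℝ, ℝ) ∞ f (chartAt E x₀).source) :
    ContDiffOn ℝ ∞ (f ∘ (chartAt E x₀).symm) (chartAt E x₀).target :=
  (hf.comp contMDiffOn_chart_symm fun _ ↦ (chartAt E x₀).map_target).contDiffOn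

theorem contDiffAt_comp_chartAt_symm {f : M → ℝ} (hf : ContMDiff 𝓘(ℝ, E) 𝓘(ℝ, ℝ) ∞ f) (p : M) :
    ContDiffAt ℝ ∞ (f ∘ (chartAt E p).symm) (chartAt E p p) :=
  (contDiffOn_comp_symm hf.contMDiffOn).contDiffAt
    ((chartAt E p).open_target.mem_nhds (mem_chart_target E p))

theorem contDiffOn_fieldIn {X : Π x : M, TangentSpace 𝓘(ℝ, E) x}
    (hX : ContMDiffOn 𝓘(ℝ, E) (𝓘(ℝ, E).prod 𝓘(ℝ, E)) ∞
      (fun x ↦ Bundle.TotalSpace.mk' E (E := fun x : M ↦ TangentSpace 𝓘(ℝ, E) x) x (X x))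
      (chartAt E x₀).source) :
    ContDiffOn ℝ ∞ (fieldIn (chartAt E x₀) X) (chartAt E x₀).target := by
  let e := trivializationAt E (TangentSpace 𝓘(ℝ, E) (M := M)) x₀
  have hsection := (e.contMDiffOn_section_baseSet_iff (IB := 𝓘(ℝ, E)) (n := ∞) (s := X)).1 hX
  have hcomp := hsection.comp (contMDiffOn_chart_symm (I := 𝓘(ℝ, E)) (n := ∞))
    fun _ ↦ (chartAt E x₀).map_target
  refine contMDiffOn_iff_contDiffOn.1 (hcomp.congr fun y hy ↦ ?_)
  have hs : (chartAt E x₀).symm y ∈ e.baseSet := (chartAt E x₀).map_target hy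
  have h := continuousLinearMapAt_eq_chartDeriv hs (X ((chartAt E x₀).symm y))
  rw [Bundle.Trivialization.continuousLinearMapAt_apply, e.linearMapAt_apply, if_pos hs] at h
  exact h.symm

variable [FiniteDimensional ℝ E]

theorem contDiffOn_bilinIn
    {g : Π x : M, TangentSpace 𝓘(ℝ, E) x →L[ℝ] TangentSpace 𝓘(ℝ, E) x →L[ℝ] ℝ}
    (hg : ContMDiff 𝓘(ℝ, E) (𝓘(ℝ, E).prod 𝓘(ℝ, E →L[ℝ] E →L[ℝ] ℝ)) ∞
      (fun x ↦ Bundle.TotalSpace.mk' (E →L[ℝ] E →L[ℝ] ℝ)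
        (E := fun x : M ↦ TangentSpace 𝓘(ℝ, E) x →L[ℝ] TangentSpace 𝓘(ℝ, E) x →L[ℝ]
          Bundle.Trivial M ℝ x) x (g x))) :
    ContDiffOn ℝ ∞ (bilinIn (chartAt E x₀) g) (chartAt E x₀).target := by
  let e := trivializationAt E (TangentSpace 𝓘(ℝ, E) (M := M)) x₀
  refine contDiffOn_clm_apply.2 fun u ↦ contDiffOn_clm_apply.2 fun v ↦ ?_
  have hsection : ContMDiffOn 𝓘(ℝ, E) (𝓘(ℝ, E).prod 𝓘(ℝ, ℝ)) ∞
      (fun x ↦ Bundle.TotalSpace.mk' ℝ (E := Bundle.Trivial M ℝ) x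
        (g x (e.symmL ℝ x u) (e.symmL ℝ x v))) (chartAt E x₀).source :=
    ContMDiffOn.clm_bundle_apply₂ (F₁ := E) (F₂ := E) hg.contMDiffOn (contMDiffOn_symmL u)
      (contMDiffOn_symmL v)
  have hfun : ContMDiffOn 𝓘(ℝ, E) 𝓘(ℝ, ℝ) ∞ (fun x ↦ g x (e.symmL ℝ x u) (e.symmL ℝ x v))
      (chartAt E x₀).source := fun x hx ↦ (Bundle.contMDiffWithinAt_totalSpace.1 (hsection x hx)).2
  refine (contDiffOn_comp_symm hfun).congr fun y hy ↦ ?_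
  rw [bilinIn_apply, Function.comp_apply, symmL_eq_chartSymmDeriv hy, symmL_eq_chartSymmDeriv hy]

theorem contDiffOn_endoIn {Φ : Π x : M, TangentSpace 𝓘(ℝ, E) x →L[ℝ] TangentSpace 𝓘(ℝ, E) x}
    (hΦ : ContMDiff 𝓘(ℝ, E) (𝓘(ℝ, E).prod 𝓘(ℝ, E →L[ℝ] E)) ∞
      (fun x ↦ Bundle.TotalSpace.mk' (E →L[ℝ] E)
        (E := fun x : M ↦ TangentSpace 𝓘(ℝ, E) x →L[ℝ] TangentSpace 𝓘(ℝ, E) x) x (Φ x))) :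
    ContDiffOn ℝ ∞ (endoIn (chartAt E x₀) Φ) (chartAt E x₀).target := by
  refine contDiffOn_clm_apply.2 fun u ↦ ?_
  have hfield := contDiffOn_fieldIn (ContMDiffOn.clm_bundle_apply (F₁ := E) (F₂ := E)
    hΦ.contMDiffOn (contMDiffOn_symmL (x₀ := x₀) u))
  refine hfield.congr fun y hy ↦ ?_
  rw [fieldIn_apply, symmL_eq_chartSymmDeriv hy, endoIn_apply]

end Smooth

end Chart

section TorseForming

variable {E : Type*} [NormedAddCommGroup E] [NormedSpace ℝ E]
  {M : Type*} [TopologicalSpace M] [ChartedSpace E M]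
  {g : Π x : M, TangentSpace 𝓘(ℝ, E) x →L[ℝ] TangentSpace 𝓘(ℝ, E) x →L[ℝ] ℝ}
  {ξ : Π x : M, TangentSpace 𝓘(ℝ, E) x} {η : Π x : M, TangentSpace 𝓘(ℝ, E) x →L[ℝ] ℝ}

/-- `ξ` is a unit torse-forming field for the pseudo-Riemannian metric `g`, with metrically dual
form `η`: it satisfies `∇_X ξ = X - η(X) ξ`. This identity between tensors is read in the preferred
charts. -/
def IsUnitTorseForming (g : Π x : M, TangentSpace 𝓘(ℝ, E) x →L[ℝ] TangentSpace 𝓘(ℝ, E) x →L[ℝ] ℝ)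
    (ξ : Π x : M, TangentSpace 𝓘(ℝ, E) x) (η : Π x : M, TangentSpace 𝓘(ℝ, E) x →L[ℝ] ℝ) : Prop :=
  ∀ x₀, Coord.IsUnitTorseFormingOn (chartAt E x₀).target (bilinIn (chartAt E x₀) g)
    (fieldIn (chartAt E x₀) ξ) (formIn (chartAt E x₀) η)

/-- The metric `a g + a (a - 1) η ⊗ η`, which for an almost contact metric structure is the metric
of its `D`-homothetic deformation with constant `a`. -/
noncomputable def homotheticDeformation
    (g : Π x : M, TangentSpace 𝓘(ℝ, E) x →L[ℝ] TangentSpace 𝓘(ℝ, E) x →L[ℝ] ℝ)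
    (η : Π x : M, TangentSpace 𝓘(ℝ, E) x →L[ℝ] ℝ) (a : ℝ) (x : M) :
    TangentSpace 𝓘(ℝ, E) x →L[ℝ] TangentSpace 𝓘(ℝ, E) x →L[ℝ] ℝ :=
  a • g x + (a * (a - 1)) • (η x).smulRight (η x)

theorem bilinIn_homotheticDeformation (c : OpenPartialHomeomorph M E)
    (g : Π x : M, TangentSpace 𝓘(ℝ, E) x →L[ℝ] TangentSpace 𝓘(ℝ, E) x →L[ℝ] ℝ)
    (η : Π x : M, TangentSpace 𝓘(ℝ, E) x →L[ℝ] ℝ) (a : ℝ) :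
    bilinIn c (homotheticDeformation g η a) = Coord.deform (bilinIn c g) (formIn c η) a := by
  funext y
  ext u v
  rfl

variable [IsManifold 𝓘(ℝ, E) ∞ M] {f : M → ℝ}

theorem dirDeriv_eq_fderiv_chartAt (hf : MDifferentiable 𝓘(ℝ, E) 𝓘(ℝ, ℝ) f) (p : M) :
    dirDeriv ξ f p = fderiv ℝ (f ∘ (chartAt E p).symm) (chartAt E p p)
      (fieldIn (chartAt E p) ξ (chartAt E p p)) := by
  have h := dirDeriv_symm (mdifferentiable_chartAt p) (mem_chart_target E p) (hf _) ξ
  rwa [(chartAt E p).left_inv (mem_chart_source E p)] at h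

theorem IsUnitTorseForming.dirDeriv_dirDeriv (h : IsUnitTorseForming g ξ η)
    (hf : ContMDiff 𝓘(ℝ, E) 𝓘(ℝ, ℝ) ∞ f) (p : M) :
    dirDeriv ξ (dirDeriv ξ f) p =
      Coord.hessian (bilinIn (chartAt E p) g) (f ∘ (chartAt E p).symm) (chartAt E p p)
        (fieldIn (chartAt E p) ξ (chartAt E p p)) (fieldIn (chartAt E p) ξ (chartAt E p p)) := by
  set c := chartAt E p
  have hc := mdifferentiable_chartAt (E := E) p
  have hy : c p ∈ c.target := mem_chart_target E p
  have hF : ContDiffAt ℝ 2 (f ∘ c.symm) (c p) :=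
    (contDiffAt_comp_chartAt_symm hf p).of_le ENat.LEInfty.out
  have hF' : DifferentiableAt ℝ (fderiv ℝ (f ∘ c.symm)) (c p) :=
    (hF.fderiv_right (m := 1) le_rfl).differentiableAt (by simp)
  have hξf : dirDeriv ξ f ∘ c.symm =ᶠ[nhds (c p)]
      fun z ↦ fderiv ℝ (f ∘ c.symm) z (fieldIn c ξ z) := by
    filter_upwards [c.open_target.mem_nhds hy] with z hz using
      dirDeriv_symm hc hz (hf.mdifferentiableAt (by simp)) ξ
  have hmd := mdifferentiableAt_symm_of_comp_symm hc hy
    ((hF'.clm_apply ((h p).differentiableAt_field hy)).congr_of_eventuallyEq hξf)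
  have hξξf := dirDeriv_symm hc hy hmd ξ
  rwa [c.left_inv (mem_chart_source E p), hξf.fderiv_eq, ← (h p).hessian_field_field hy hF] at hξξf

theorem IsUnitTorseForming.exists_ricci_eq [FiniteDimensional ℝ E] (h : IsUnitTorseForming g ξ η)
    {a : ℝ} (ha : a ≠ 0) (hf : ContMDiff 𝓘(ℝ, E) 𝓘(ℝ, ℝ) ∞ f) {lam : M → ℝ}
    (hsol : IsAlmostRiemannSoliton (homotheticDeformation g η a)
      (grad (homotheticDeformation g η a) f) lam) (p : M) :
    let c := chartAt E p
    ∃ r : ℝ, Coord.ricci (bilinIn c g) (c p) =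
      (-(Module.finrank ℝ E - 2) : ℝ) • (Coord.hessian (bilinIn c g) (f ∘ c.symm) (c p) +
        ((a - 1) / a * (dirDeriv ξ f p - dirDeriv ξ (dirDeriv ξ f) p)) •
          (bilinIn c g (c p) (fieldIn c ξ (c p))).smulRight
            (bilinIn c g (c p) (fieldIn c ξ (c p)))) + r • bilinIn c g (c p) := by
  intro c
  have hy : c p ∈ c.target := mem_chart_target E p
  have hG := (h p).isPseudoRiemannianOn_deform ha
  have hmd : MDifferentiable 𝓘(ℝ, E) 𝓘(ℝ, ℝ) f := hf.mdifferentiable (by simp)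
  have hF : ContDiffAt ℝ 2 (f ∘ c.symm) (c p) :=
    (contDiffAt_comp_chartAt_symm hf p).of_le ENat.LEInfty.out
  have hV := ((contDiffOn_fieldIn (x₀ := p) hsol.smooth_field.contMDiffOn).contDiffAt
    (c.open_target.mem_nhds hy)).differentiableAt (by simp)
  rw [← bilinIn_homotheticDeformation] at hG
  obtain ⟨s, hs⟩ := hG.exists_ricci_eq_of_gradient_soliton hy hF hV
    (fun z hz ↦ bilinIn_fieldIn_grad (mdifferentiable_chartAt p) hz (hG.isInvertible z hz) (hmd _))
    (hsol.equation c (chart_mem_atlas E p) _ hy)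
  rw [dirDeriv_eq_fderiv_chartAt hmd, h.dirDeriv_dirDeriv hf]
  rw [bilinIn_homotheticDeformation] at hs
  exact (h p).ricci_eq_of_ricci_deform_eq ha hy hs

end TorseForming

namespace AlmostContactMetricStructure

variable {E : Type*} [NormedAddCommGroup E] [NormedSpace ℝ E]
  {M : Type*} [TopologicalSpace M] [ChartedSpace E M] [IsManifold 𝓘(ℝ, E) ∞ M]
  (S : AlmostContactMetricStructure E M)

theorem φ_ξ (x : M) : S.φ x (S.ξ x) = 0 := by
  by_contra h
  have hpos := S.metric.pos x _ h
  rw [S.metric_φ_φ, ← S.η_eq, S.η_ξ] at hpos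
  norm_num at hpos

theorem η_φ (x : M) (v : TangentSpace 𝓘(ℝ, E) x) : S.η x (S.φ x v) = 0 := by
  have h := congrArg (S.φ x) (S.φ_φ x v)
  rw [S.φ_φ x (S.φ x v), map_add, map_neg, map_smul, S.φ_ξ, smul_zero, add_zero, add_eq_left] at h
  simpa [S.η_ξ] using congrArg (S.η x) h

theorem formIn_η {c : OpenPartialHomeomorph M E} (hc : c.MDifferentiable 𝓘(ℝ, E) 𝓘(ℝ, E)) {y : E}
    (hy : y ∈ c.target) : formIn c S.η y = bilinIn c S.g y (fieldIn c S.ξ y) := by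
  ext v
  rw [formIn_apply, bilinIn_apply, fieldIn_apply, chartSymmDeriv_chartDeriv hc hy, S.η_eq, g]

theorem formIn_η_fieldIn_ξ {c : OpenPartialHomeomorph M E}
    (hc : c.MDifferentiable 𝓘(ℝ, E) 𝓘(ℝ, E)) {y : E} (hy : y ∈ c.target) :
    formIn c S.η y (fieldIn c S.ξ y) = 1 := by
  rw [formIn_apply, fieldIn_apply, chartSymmDeriv_chartDeriv hc hy, S.η_ξ]

variable [FiniteDimensional ℝ E]

theorem isPseudoRiemannianOn_bilinIn (x₀ : M) :
    Coord.IsPseudoRiemannianOn (chartAt E x₀).target (bilinIn (chartAt E x₀) S.g) where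
  isOpen := (chartAt E x₀).open_target
  contDiffOn := (contDiffOn_bilinIn S.metric.contMDiff).of_le ENat.LEInfty.out
  symm _ _ _ _ := S.metric.symm _ _ _
  isInvertible _ hy := isInvertible_of_forall_apply_self_pos fun u hu ↦
    S.metric.pos _ _ fun h₀ ↦ hu <|
      (chartDeriv_chartSymmDeriv (mdifferentiable_chartAt x₀) hy u).symm.trans
        ((congrArg _ h₀).trans (map_zero _))

theorem IsKenmotsu.isUnitTorseForming {S : AlmostContactMetricStructure E M} (hS : S.IsKenmotsu) :
    IsUnitTorseForming S.g S.ξ S.η := by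
  intro x₀
  have hc := mdifferentiable_chartAt (E := E) x₀
  set c := chartAt E x₀
  have hG : Coord.IsPseudoRiemannianOn c.target (bilinIn c S.g) := S.isPseudoRiemannianOn_bilinIn x₀
  have hξ : ContDiffOn ℝ 2 (fieldIn c S.ξ) c.target :=
    (contDiffOn_fieldIn S.contMDiff_ξ.contMDiffOn).of_le ENat.LEInfty.out
  have covDeriv_field : ∀ y ∈ c.target, ∀ u, Coord.covDeriv (bilinIn c S.g) (fieldIn c S.ξ) y u =
      u - formIn c S.η y u • fieldIn c S.ξ y := by
    intro y hy
    have hmem := c.open_target.mem_nhds hy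
    rw [S.formIn_η hc hy]
    refine hG.covDeriv_eq_of_covDerivEndo hy (Φ := endoIn c S.φ)
      (((contDiffOn_endoIn S.contMDiff_φ).contDiffAt hmem).differentiableAt (by simp))
      ((hξ.contDiffAt hmem).differentiableAt (by simp)) (fun z hz ↦ ?_) (fun z hz ↦ ?_)
      (fun v ↦ ?_) (fun u ↦ ?_)
    · rw [← S.formIn_η hc hz, S.formIn_η_fieldIn_ξ hc hz]
    · rw [endoIn_apply, fieldIn_apply, chartSymmDeriv_chartDeriv hc hz, S.φ_ξ, map_zero]
    · rw [← S.formIn_η hc hy, endoIn_apply, endoIn_apply, chartSymmDeriv_chartDeriv hc hy, S.φ_φ,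
        map_add, map_neg, map_smul, chartDeriv_chartSymmDeriv hc hy, formIn_apply, fieldIn_apply]
    · have form_endo : formIn c S.η y (endoIn c S.φ y u) = 0 := by
        rw [endoIn_apply, formIn_apply, chartSymmDeriv_chartDeriv hc hy, S.η_φ]
      rw [hS c (chart_mem_atlas E x₀) y hy, hG.symm y hy, ← S.formIn_η hc hy, form_endo,
        S.formIn_η_fieldIn_ξ hc hy, zero_smul, one_smul, zero_sub]
  exact { hG with
    contDiffOn_field := hξ
    form_eq := fun _ hy ↦ S.formIn_η hc hy
    form_field := fun _ hy ↦ S.formIn_η_fieldIn_ξ hc hy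
    covDeriv_field }

end AlmostContactMetricStructure

theorem mainTheorem9_general {E : Type*} [NormedAddCommGroup E] [NormedSpace ℝ E]
    [FiniteDimensional ℝ E] {M : Type*} [TopologicalSpace M] [ChartedSpace E M]
    [IsManifold 𝓘(ℝ, E) ∞ M]
    {g : Π x : M, TangentSpace 𝓘(ℝ, E) x →L[ℝ] TangentSpace 𝓘(ℝ, E) x →L[ℝ] ℝ}
    {ξ : Π x : M, TangentSpace 𝓘(ℝ, E) x} {η : Π x : M, TangentSpace 𝓘(ℝ, E) x →L[ℝ] ℝ}
    (h : IsUnitTorseForming g ξ η) {a : ℝ} (ha : a ≠ 0)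
    {f : M → ℝ} (hf : ContMDiff 𝓘(ℝ, E) 𝓘(ℝ, ℝ) ∞ f) {lam : M → ℝ}
    (hsol : IsAlmostRiemannSoliton (homotheticDeformation g η a)
      (grad (homotheticDeformation g η a) f) lam)
    (p : M) {N k δ : ℝ} (hN : N = Module.finrank ℝ E) (hk : k = (a - 1) / a)
    (hδ : δ = dirDeriv ξ f p - dirDeriv ξ (dirDeriv ξ f) p) :
    (N - 2) ^ 2 * (hessNormSq g f p + 2 * (k * δ) * dirDeriv ξ (dirDeriv ξ f) p + (k * δ) ^ 2
        - (laplacian g f p + k * δ) ^ 2 / N)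
      - 2 * ((N - 1) * k) * scal g p - ((N - 1) * k) ^ 2 * N ≤ ricciNormSq g p := by
  subst hN hk hδ
  have hp : chartAt E p p ∈ (chartAt E p).target := mem_chart_target E p
  have hG := (h p).isInvertible _ hp
  have hsymm := (h p).symm _ hp
  have hhess := (h p).hessian_symm hp ((contDiffAt_comp_chartAt_symm hf p).of_le ENat.LEInfty.out)
  have := (h p).nontrivial hp
  obtain ⟨r, hr⟩ := h.exists_ricci_eq ha hf hsol p
  have hle := sq_mul_tracelessNormSq_le_of_eq_smul_add_smul_self hG hsymm
    (fun u v ↦ by simp [hhess u v, mul_comm]) hr ((Module.finrank ℝ E - 1) * ((a - 1) / a))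
  rw [tracelessNormSq_add_smul_smulRight hG hsymm hhess, (h p).metric_field_field hp,
    ← h.dirDeriv_dirDeriv hf, mul_one] at hle
  simp only [hessNormSq, laplacian, scal, ricciNormSq]
  linear_combination hle

theorem mainTheorem9 {E : Type*} [NormedAddCommGroup E] [NormedSpace ℝ E] [FiniteDimensional ℝ E]
    {M : Type*} [TopologicalSpace M] [ChartedSpace E M] [IsManifold 𝓘(ℝ, E) ∞ M]
    (n : ℕ) (hn : Module.finrank ℝ E = 2 * n + 1)
    (S : AlmostContactMetricStructure E M) (hS : S.IsKenmotsu)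
    (a : ℝ) (ha : 0 < a)
    (f : M → ℝ) (hf : ContMDiff 𝓘(ℝ, E) 𝓘(ℝ, ℝ) ∞ f) (lam : M → ℝ)
    (hsol : IsAlmostRiemannSoliton (S.deformedMetric a) (grad (S.deformedMetric a) f) lam)
    (p : M) :
    ricciNormSq S.g p ≥
      (2 * (n : ℝ) - 1) ^ 2 * hessNormSq S.g f p
      - 4 * n * ((a - 1) / a) * scal S.g p
      - 4 * n ^ 2 * (2 * n + 1) * ((a - 1) / a) ^ 2
      - (2 * n - 1) ^ 2 / (2 * n + 1) * laplacian S.g f p ^ 2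
      - 2 * (2 * n - 1) ^ 2 / (2 * n + 1) * ((a - 1) / a)
        * (dirDeriv S.ξ f p - dirDeriv S.ξ (dirDeriv S.ξ f) p) * laplacian S.g f p
      + 2 * n * (2 * n - 1) ^ 2 / (2 * n + 1) * ((a - 1) / a) ^ 2 * dirDeriv S.ξ f p ^ 2
      - 2 * (2 * n - 1) ^ 2 * (n + n * a + a) * (a - 1) / ((2 * n + 1) * a ^ 2)
        * dirDeriv S.ξ (dirDeriv S.ξ f) p ^ 2
      + 2 * (2 * n - 1) ^ 2 * (2 * n + a) * (a - 1) / ((2 * n + 1) * a ^ 2)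
        * (dirDeriv S.ξ f p * dirDeriv S.ξ (dirDeriv S.ξ f) p) := by
  have hgap := mainTheorem9_general hS.isUnitTorseForming ha.ne' hf hsol p rfl rfl rfl
  rw [hn] at hgap
  refine le_of_eq_of_le ?_ hgap
  push_cast
  field_simp
  ring
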